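/- Fix $\theta,\lambda\in\mathbb R$, $\sigma>0$, a weight $w>0$, and put $$p(x)=\frac{\sigma^2}{2\theta}\bigl(1-e^{-2\theta x}\bigr)\ \ (\theta\neq 0),\qquad p(x)=\sigma^2x\ \ (\theta=0).$$ Let $Y_0,Y_1,\ldots\ge 0$ be i.i.d. transmission times with $0<\mathbb E[Y_0]<\infty$ and $\mathbb E\bigl[\int_0^{Y_0+Y_1}p(s)\,ds\bigr]<\infty$ (automatic if $\theta>0$). A causal signal-agnostic policy is a sequence of sampling times $0=S_0\le S_1\le\cdots$ in $[0,\infty]$ such that, with delivery times $D_i=S_i+Y_i$, one has $S_{i+1}\ge D_i$, and $(Y_0,\ldots,Y_i,S_0,\ldots,S_{i+1})$ is independent of $(Y_{i+1},Y_{i+2},\ldots)$ for all $i\ge 0$. Its age of information is $\Delta(t)=t-S_i$ for $t\in[D_i,D_{i+1})$, with $\Delta(t)=t$ for $t<D_0$, and its channel occupation is $c(t)=1$ if $t\in[S_i,D_i)$ for some $i$, and $c(t)=0$ otherwise. The per-bandit problem with activation cost $\lambda$ is $$\bar m=\inf_{(S_i)}\ \limsup_{T\to\infty}\mathbb E\left[\frac1T\int_0^T\bigl(w\,p(\Delta(t))+\lambda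 c(t)\bigr)\,dt\right].$$ For $\beta\in\mathbb R$ let $S(\beta)$ be the policy with $S_0(\beta)=0$, $D_i(\beta)=S_i(\beta)+Y_i$ and $$S_{i+1}(\beta)=\inf\Bigl\{t\ge D_i(\beta):\ w\,\mathbb E\bigl[p(\Delta(t)+Y_{i+1})\bigr]\ge\beta\Bigr\},\qquad \Delta(t)=t-S_i(\beta),$$ where the expectation is over $Y_{i+1}$ only, $t$ is finite, and $\inf\emptyset=\infty$. (a) If $\theta\le 0$, or if $\theta>0$ and $\lambda\,\mathbb E[Y_0]<\frac{w\sigma^2}{4\theta^2}\mathbb E[e^{-2\theta Y_0}]$, then there is a $\beta\in\mathbb R$, the same for all $i\ge 0$, that is for every $i$ the unique root of $$\mathbb E\left[\int_{D_i(\beta)}^{D_{i+1}(\beta)}w\,p(\Delta(t))\,dt\right]+\lambda\,\mathbb E[Y_{i+1}]-\beta\,\mathbb E\bigl[D_{i+1}(\beta)-D_i(\beta)\bigr]=0$$ (where a root is required to make $D_{i+1}(\beta)$ almost surely finite and both expectations over the cycle finite). For this $\beta$ the policy $S(\beta)$ is optimal, and $$\bar m=\frac{\mathbb E\left[\int_{D_i(\beta)}^{D_{i+1}(\beta)}w\,p(\Delta(t))\,dt\right]+\lambda\,\mathbb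 E[Y_{i+1}]}{\mathbb E\bigl[D_{i+1}(\beta)-D_i(\beta)\bigr]}=\beta\qquad\text{for all } i\ge 0.$$ (b) If $\theta>0$ and $\lambda\,\mathbb E[Y_0]\ge\frac{w\sigma^2}{4\theta^2}\mathbb E[e^{-2\theta Y_0}]$, then the equation has no root, $\bar m=\frac{w\sigma^2}{2\theta}$, and the policy $S(\bar m)$, for which $S_i=\infty$ for all $i\ge1$, is optimal. -/

import Mathlib

open MeasureTheory ProbabilityTheory Filter
open scoped NNReal ENNReal

noncomputable section

namespace AoISampling

/-- Mean-squared error of the MMSE estimate of a Gauss-Markov process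
`dX = θ (μ - X) dt + σ dW` when the freshest received sample has age `x`. -/
def penalty (θ σ x : ℝ) : ℝ :=
  if θ = 0 then σ ^ 2 * x else σ ^ 2 / (2 * θ) * (1 - Real.exp (-2 * θ * x))

variable {Ω : Type*}

/-- Delivery time `D i = S i + Y i` of sample `i`. Sampling times may be `∞`
(the sample is never taken). -/
def delivery (Y : ℕ → Ω → ℝ≥0) (S : ℕ → Ω → ℝ≥0∞) (i : ℕ) (ω : Ω) : ℝ≥0∞ :=
  S i ω + (Y i ω : ℝ≥0∞)

/-- Generation time of the freshest sample delivered by time `t` (and `0 = S 0` before the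
first delivery). It is never larger than `t`. -/
def freshest (Y : ℕ → Ω → ℝ≥0) (S : ℕ → Ω → ℝ≥0∞) (t : ℝ) (ω : Ω) : ℝ≥0∞ :=
  ⨆ i, if delivery Y S i ω ≤ ENNReal.ofReal t then S i ω else 0

/-- Age of information at time `t`. -/
def age (Y : ℕ → Ω → ℝ≥0) (S : ℕ → Ω → ℝ≥0∞) (t : ℝ) (ω : Ω) : ℝ :=
  t - (freshest Y S t ω).toReal

open Classical in
/-- Channel occupation: `1` if some sample is in service at time `t`, and `0` otherwise. -/
def occupation (Y : ℕ → Ω → ℝ≥0) (S : ℕ → Ω → ℝ≥0∞) (t : ℝ) (ω : Ω) : ℝ :=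
  if ∃ i, S i ω ≤ ENNReal.ofReal t ∧ ENNReal.ofReal t < delivery Y S i ω then 1 else 0

variable [MeasurableSpace Ω]

/-- What is known when sample `i + 1` is taken: the transmission times of the samples
`0, …, i`, and the sampling times up to and including the one just chosen. -/
@[reducible] def history (Y : ℕ → Ω → ℝ≥0) (S : ℕ → Ω → ℝ≥0∞) (i : ℕ) : MeasurableSpace Ω :=
  (⨆ j ≤ i, MeasurableSpace.comap (Y j) inferInstance) ⊔
    ⨆ j ≤ i + 1, MeasurableSpace.comap (S j) inferInstance

/-- The transmission times of the samples `i + 1, i + 2, …`. -/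
@[reducible] def future (Y : ℕ → Ω → ℝ≥0) (i : ℕ) : MeasurableSpace Ω :=
  ⨆ j > i, MeasurableSpace.comap (Y j) inferInstance

/-- Causal signal-agnostic sampling policies of one source. Every sample is taken and submitted
after the previous delivery, and no sampling decision uses future transmission times (the
decision may use past transmission times and independent randomization). -/
structure IsCausal (P : Measure Ω) (Y : ℕ → Ω → ℝ≥0) (S : ℕ → Ω → ℝ≥0∞) : Prop where
  measurable : ∀ i, Measurable (S i)
  zero : ∀ ω, S 0 ω = 0
  delivery_le : ∀ i ω, delivery Y S i ω ≤ S (i + 1) ω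
  causal : ∀ i, Indep (history Y S i) (future Y i) P

/-- Long-run average expected cost
`limsup_{T → ∞} E[(1/T) ∫_0^T (w p(Δ(t)) + lam c(t)) dt]`.
The inner expectation is finite for each `T` because `0 ≤ Δ(t) ≤ t`. -/
def avgCost (P : Measure Ω) (θ σ w lam : ℝ) (Y : ℕ → Ω → ℝ≥0) (S : ℕ → Ω → ℝ≥0∞) : EReal :=
  limsup (fun T : ℝ =>
    ((∫ ω, (1 / T * ∫ t in (0 : ℝ)..T,
      (w * penalty θ σ (age Y S t ω) + lam * occupation Y S t ω)) ∂P : ℝ) : EReal)) atTop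

/-- Optimal value of the per-bandit problem with activation cost `lam`. -/
def optValue (P : Measure Ω) (θ σ w lam : ℝ) (Y : ℕ → Ω → ℝ≥0) : EReal :=
  ⨅ (S : ℕ → Ω → ℝ≥0∞) (_ : IsCausal P Y S), avgCost P θ σ w lam Y S

/-- `S` is an optimal solution of the per-bandit problem. -/
def IsOptimal (P : Measure Ω) (θ σ w lam : ℝ) (Y : ℕ → Ω → ℝ≥0) (S : ℕ → Ω → ℝ≥0∞) : Prop :=
  IsCausal P Y S ∧ avgCost P θ σ w lam Y S = optValue P θ σ w lam Y

/-- Threshold sampling times with parameter `β`: `S 0 = 0`, and `S (i + 1)` is the first time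
`t ≥ D i` at which `w E[p(t - S i + Y (i + 1))] ≥ β`, where the expectation is over
`Y (i + 1)` only (`∞` if there is no such time). -/
def threshold (P : Measure Ω) (θ σ w : ℝ) (Y : ℕ → Ω → ℝ≥0) (β : ℝ) : ℕ → Ω → ℝ≥0∞
  | 0, _ => 0
  | i + 1, ω => sInf {t : ℝ≥0∞ | t ≠ ∞ ∧
      threshold P θ σ w Y β i ω + (Y i ω : ℝ≥0∞) ≤ t ∧
      β ≤ w * ∫ ω', penalty θ σ ((t - threshold P θ σ w Y β i ω).toReal + Y (i + 1) ω') ∂P}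

/-- Length `D (i + 1) - D i` of a delivery cycle. -/
def cycleLength (Y : ℕ → Ω → ℝ≥0) (S : ℕ → Ω → ℝ≥0∞) (i : ℕ) (ω : Ω) : ℝ :=
  (delivery Y S (i + 1) ω).toReal - (delivery Y S i ω).toReal

/-- Weighted penalty `∫_{D i}^{D (i + 1)} w p(Δ(t)) dt` over a delivery cycle. -/
def cycleCost (θ σ w : ℝ) (Y : ℕ → Ω → ℝ≥0) (S : ℕ → Ω → ℝ≥0∞) (i : ℕ) (ω : Ω) : ℝ :=
  ∫ t in (delivery Y S i ω).toReal..(delivery Y S (i + 1) ω).toReal,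
    w * penalty θ σ (age Y S t ω)

/-- `β` solves, for the delivery cycle `i` of the threshold policy with parameter `β`,
`E[∫_{D i}^{D (i + 1)} w p(Δ(t)) dt] + lam E[Y (i + 1)] - β E[D (i + 1) - D i] = 0`.
All terms of the equation are required to be well defined and finite. -/
structure IsRoot (P : Measure Ω) (θ σ w lam : ℝ) (Y : ℕ → Ω → ℝ≥0) (i : ℕ) (β : ℝ) : Prop where
  finite : ∀ᵐ ω ∂P, delivery Y (threshold P θ σ w Y β) (i + 1) ω ≠ ∞
  integrable_length : Integrable (cycleLength Y (threshold P θ σ w Y β) i) P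
  integrable_cost : Integrable (cycleCost θ σ w Y (threshold P θ σ w Y β) i) P
  eq_zero : ∫ ω, cycleCost θ σ w Y (threshold P θ σ w Y β) i ω ∂P
      + lam * ∫ ω, (Y (i + 1) ω : ℝ) ∂P
      - β * ∫ ω, cycleLength Y (threshold P θ σ w Y β) i ω ∂P = 0

end AoISampling

end

set_option linter.unusedSectionVars false

noncomputable section

namespace AoISampling

/-! Write `r = w p`, let `R = prim r` be its primitive, `ν` the law of a transmission time `Y`, and
subtract a reward `b` per unit of time. A delivery resets the age to the transmission time just
completed, so cycles interact only through that age. A sample taken at age `u` contributes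
`sampleCost u = E R(u + Y) - b u`, up to terms that do not depend on `u`. This function is convex
with slope `deliveryRate u - b`, so from age `a` the best choice is `u = max a τ`, where `τ` is the
age at which the expected rate at delivery reaches `b`. The expected net cost of a cycle is then
`gain b τ`, and the optimal value is the `b` at which it vanishes.

Existence and uniqueness of `b`. For fixed `τ`, `gain` is affine in `b` with slope minus the mean
cycle length, and the right threshold minimises it over `τ`. The minimum is therefore a lower
envelope of decreasing affine functions: Lipschitz on half-lines of attainable `b`, strictly
decreasing, and nonnegative for `b ≤ -|lam|`. It takes a negative value if `θ ≤ 0`, because the rate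
is then unbounded and every `b` is attainable. For `θ > 0` the rate saturates at `w σ² / (2θ)`, and
the sign of `gain` at that level as `τ → ∞` gives the condition on `lam` (`gain_of_pos`).

Optimality. A `Certificate` provides a function `Q` such that `relValue` satisfies one side of the
Bellman inequalities along the given policy. Summing a pathwise inequality over the samples taken
before `T` (`segment_cost_ge`), and using that the decision to sample is independent of the coming
transmission, gives the asymptotic bound `b ≤ meanCost` (`Certificate.eventually_le`). Upper bounds
come from the same theorem applied to `-r`, `-lam`, `-b`: there the inequalities are needed only
along the candidate policy, where they are equalities or trivial.

The theorem needs `relValue` bounded above, which for the lower bound requires a bounded rate. When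
`r` is unbounded it is first truncated at a level `M`; this lowers every cost, and the admissible
`b` drops by an arbitrarily small amount (`IsRate.exists_truncRate`). -/

/-- The primitive of a rate function that vanishes at `0`. -/
def prim (r : ℝ → ℝ) (x : ℝ) : ℝ := ∫ s in (0 : ℝ)..x, r s

lemma integral_eq_prim_sub {r : ℝ → ℝ} (hr : Continuous r) (a b : ℝ) :
    ∫ s in a..b, r s = prim r b - prim r a := by
  unfold prim
  rw [intervalIntegral.integral_interval_sub_left] <;> exact hr.intervalIntegrable _ _

lemma continuous_prim {r : ℝ → ℝ} (hr : Continuous r) : Continuous (prim r) :=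
  intervalIntegral.continuous_primitive (fun a b => hr.intervalIntegrable a b) 0

/-! ### Trajectories: age, occupation and running cost -/

section Paths

variable {Ω : Type*} {Y : ℕ → Ω → ℝ≥0} {S : ℕ → Ω → ℝ≥0∞}

lemma sampling_mono (hd : ∀ i ω, delivery Y S i ω ≤ S (i + 1) ω) (ω : Ω) :
    Monotone fun n => S n ω :=
  monotone_nat_of_le_succ fun n => le_self_add.trans (hd n ω)

lemma delivery_mono (hd : ∀ i ω, delivery Y S i ω ≤ S (i + 1) ω) (ω : Ω) :
    Monotone fun n => delivery Y S n ω :=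
  monotone_nat_of_le_succ fun n => (hd n ω).trans le_self_add

/-- For `n = 0` the truncated subtraction gives `S (0 - 1) = S 0 = 0`, which matches the convention
that the age is `t` before the first delivery. -/
lemma freshest_in_service (h0 : ∀ ω, S 0 ω = 0) (hd : ∀ i ω, delivery Y S i ω ≤ S (i + 1) ω)
    {n : ℕ} {ω : Ω} {t : ℝ} (h1 : S n ω ≤ ENNReal.ofReal t)
    (h2 : ENNReal.ofReal t < delivery Y S n ω) : freshest Y S t ω = S (n - 1) ω := by
  unfold freshest
  apply le_antisymm
  · refine iSup_le fun i => ?_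
    split_ifs with h
    · have hi : i < n := by
        by_contra hc
        exact absurd (h2.trans_le (delivery_mono hd ω (not_lt.1 hc))) (not_lt.2 h)
      exact sampling_mono hd ω (by omega)
    · exact zero_le
  · rcases n with _ | n
    · simp [h0]
    · refine le_iSup_of_le n ?_
      rw [if_pos ((hd n ω).trans h1)]
      simp

lemma freshest_waiting (hd : ∀ i ω, delivery Y S i ω ≤ S (i + 1) ω)
    {n : ℕ} {ω : Ω} {t : ℝ} (h1 : delivery Y S n ω ≤ ENNReal.ofReal t)
    (h2 : ENNReal.ofReal t < S (n + 1) ω) : freshest Y S t ω = S n ω := by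
  unfold freshest
  apply le_antisymm
  · refine iSup_le fun i => ?_
    split_ifs with h
    · have hi : i < n + 1 := by
        by_contra hc
        have h3 : S (n + 1) ω ≤ delivery Y S i ω :=
          le_self_add.trans (delivery_mono hd ω (not_lt.1 hc))
        exact absurd (h2.trans_le h3) (not_lt.2 h)
      exact sampling_mono hd ω (by omega)
    · exact zero_le
  · refine le_iSup_of_le n ?_
    rw [if_pos h1]

lemma occupation_in_service {n : ℕ} {ω : Ω} {t : ℝ} (h1 : S n ω ≤ ENNReal.ofReal t)
    (h2 : ENNReal.ofReal t < delivery Y S n ω) : occupation Y S t ω = 1 := by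
  unfold occupation
  exact if_pos ⟨n, h1, h2⟩

lemma occupation_waiting (hd : ∀ i ω, delivery Y S i ω ≤ S (i + 1) ω)
    {n : ℕ} {ω : Ω} {t : ℝ} (h1 : delivery Y S n ω ≤ ENNReal.ofReal t)
    (h2 : ENNReal.ofReal t < S (n + 1) ω) : occupation Y S t ω = 0 := by
  unfold occupation
  refine if_neg ?_
  rintro ⟨i, hi1, hi2⟩
  have hi : n < i := by
    by_contra hc
    exact absurd (hi2.trans_le ((delivery_mono hd ω (not_lt.1 hc)).trans h1)) (lt_irrefl _)
  exact absurd ((sampling_mono hd ω (Nat.succ_le_of_lt hi)).trans hi1) (not_le.2 h2)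

lemma freshest_le (t : ℝ) (ω : Ω) : freshest Y S t ω ≤ ENNReal.ofReal t := by
  unfold freshest
  refine iSup_le fun i => ?_
  split_ifs with h
  · exact le_self_add.trans h
  · exact zero_le

lemma age_mem {t T : ℝ} (h0 : 0 ≤ t) (hT : t ≤ T) (ω : Ω) :
    age Y S t ω ∈ Set.Icc 0 T := by
  have h := ENNReal.toReal_mono ENNReal.ofReal_ne_top (freshest_le (Y := Y) (S := S) t ω)
  rw [ENNReal.toReal_ofReal h0] at h
  unfold age
  constructor
  · linarith
  · linarith [ENNReal.toReal_nonneg (a := freshest Y S t ω)]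

lemma occupation_mem (t : ℝ) (ω : Ω) : occupation Y S t ω ∈ Set.Icc (0 : ℝ) 1 := by
  unfold occupation
  split_ifs <;> simp

/-- The running cost for a rate function `r`, an activation cost `lam` and a reward `b` per unit
of time. -/
def runningCost (r : ℝ → ℝ) (lam b : ℝ) (Y : ℕ → Ω → ℝ≥0) (S : ℕ → Ω → ℝ≥0∞) (t : ℝ) (ω : Ω) :
    ℝ :=
  r (age Y S t ω) + lam * occupation Y S t ω - b

lemma exists_bound_runningCost {r : ℝ → ℝ} (hr : Continuous r) (lam b T : ℝ) :
    ∃ B, 0 ≤ B ∧ ∀ (Y : ℕ → Ω → ℝ≥0) (S : ℕ → Ω → ℝ≥0∞) (t : ℝ) (ω : Ω), 0 ≤ t → t ≤ T →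
      |runningCost r lam b Y S t ω| ≤ B := by
  obtain ⟨C, hC⟩ := (isCompact_Icc (a := (0 : ℝ)) (b := T)).exists_bound_of_continuousOn
    hr.continuousOn
  refine ⟨|C| + |lam| + |b|, by positivity, fun Y S t ω h0 hT => ?_⟩
  have h1 : |r (age Y S t ω)| ≤ |C| := (hC _ (age_mem h0 hT ω)).trans (le_abs_self C)
  have h2 : |lam * occupation Y S t ω| ≤ |lam| := by
    rw [abs_mul, abs_of_nonneg (occupation_mem t ω).1]
    exact mul_le_of_le_one_right (abs_nonneg _) (occupation_mem t ω).2
  unfold runningCost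
  calc _ ≤ |r (age Y S t ω) + lam * occupation Y S t ω| + |b| := abs_sub _ _
    _ ≤ _ := by linarith [abs_add_le (r (age Y S t ω)) (lam * occupation Y S t ω)]

lemma integral_runningCost_in_service {r : ℝ → ℝ} (hr : Continuous r) (lam b : ℝ)
    (h0 : ∀ ω, S 0 ω = 0) (hd : ∀ i ω, delivery Y S i ω ≤ S (i + 1) ω)
    {n : ℕ} {ω : Ω} {s t : ℝ} (hs : 0 ≤ s) (hst : s ≤ t) (h1 : S n ω ≤ ENNReal.ofReal s)
    (h2 : ENNReal.ofReal t ≤ delivery Y S n ω) :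
    ∫ x in s..t, runningCost r lam b Y S x ω =
      prim r (t - (S (n - 1) ω).toReal) - prim r (s - (S (n - 1) ω).toReal)
        + (lam - b) * (t - s) := by
  have h : ∫ x in s..t, runningCost r lam b Y S x ω =
      ∫ x in s..t, (r (x - (S (n - 1) ω).toReal) + (lam - b)) := by
    refine intervalIntegral.integral_congr_Ioo_of_le hst fun x hx => ?_
    have hx1 : S n ω ≤ ENNReal.ofReal x := h1.trans (ENNReal.ofReal_le_ofReal hx.1.le)
    have hx2 : ENNReal.ofReal x < delivery Y S n ω :=
      ((ENNReal.ofReal_lt_ofReal_iff (by linarith [hx.1, hx.2])).2 hx.2).trans_le h2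
    simp only [runningCost, age, freshest_in_service h0 hd hx1 hx2, occupation_in_service hx1 hx2]
    ring
  have hc : Continuous fun x => r (x - (S (n - 1) ω).toReal) := by fun_prop
  rw [h, intervalIntegral.integral_add (hc.intervalIntegrable _ _) (by simp),
    intervalIntegral.integral_comp_sub_right (fun x => r x), integral_eq_prim_sub hr]
  rw [intervalIntegral.integral_const, smul_eq_mul, mul_comm]

lemma integral_runningCost_waiting {r : ℝ → ℝ} (hr : Continuous r) (lam b : ℝ)
    (hd : ∀ i ω, delivery Y S i ω ≤ S (i + 1) ω)
    {n : ℕ} {ω : Ω} {s t : ℝ} (hs : 0 ≤ s) (hst : s ≤ t)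
    (h1 : delivery Y S n ω ≤ ENNReal.ofReal s) (h2 : ENNReal.ofReal t ≤ S (n + 1) ω) :
    ∫ x in s..t, runningCost r lam b Y S x ω =
      prim r (t - (S n ω).toReal) - prim r (s - (S n ω).toReal) - b * (t - s) := by
  have h : ∫ x in s..t, runningCost r lam b Y S x ω =
      ∫ x in s..t, (r (x - (S n ω).toReal) - b) := by
    refine intervalIntegral.integral_congr_Ioo_of_le hst fun x hx => ?_
    have hx1 : delivery Y S n ω ≤ ENNReal.ofReal x := h1.trans (ENNReal.ofReal_le_ofReal hx.1.le)
    have hx2 : ENNReal.ofReal x < S (n + 1) ω :=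
      ((ENNReal.ofReal_lt_ofReal_iff (by linarith [hx.1, hx.2])).2 hx.2).trans_le h2
    simp only [runningCost, age, freshest_waiting hd hx1 hx2, occupation_waiting hd hx1 hx2]
    ring
  have hc : Continuous fun x => r (x - (S n ω).toReal) := by fun_prop
  rw [h, intervalIntegral.integral_sub (hc.intervalIntegrable _ _) (by simp),
    intervalIntegral.integral_comp_sub_right (fun x => r x), integral_eq_prim_sub hr]
  simp [mul_comm]

variable [MeasurableSpace Ω]

lemma measurable_delivery (hY : ∀ i, Measurable (Y i)) (hS : ∀ i, Measurable (S i)) (i : ℕ) :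
    Measurable (delivery Y S i) := by
  unfold delivery
  exact (hS i).add (hY i).coe_nnreal_ennreal

lemma measurable_age (hY : ∀ i, Measurable (Y i)) (hS : ∀ i, Measurable (S i)) :
    Measurable fun z : ℝ × Ω => age Y S z.1 z.2 := by
  have h : Measurable fun z : ℝ × Ω => freshest Y S z.1 z.2 := by
    unfold freshest
    refine Measurable.iSup fun i => ?_
    refine Measurable.ite ?_ ((hS i).comp measurable_snd) measurable_const
    exact measurableSet_le ((measurable_delivery hY hS i).comp measurable_snd)
      (ENNReal.measurable_ofReal.comp measurable_fst)
  unfold age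
  exact measurable_fst.sub h.ennreal_toReal

lemma measurable_occupation (hY : ∀ i, Measurable (Y i)) (hS : ∀ i, Measurable (S i)) :
    Measurable fun z : ℝ × Ω => occupation Y S z.1 z.2 := by
  unfold occupation
  refine Measurable.ite ?_ measurable_const measurable_const
  rw [Set.ofPred_exists]
  refine MeasurableSet.iUnion fun i => MeasurableSet.inter ?_ ?_
  · exact measurableSet_le ((hS i).comp measurable_snd)
      (ENNReal.measurable_ofReal.comp measurable_fst)
  · exact measurableSet_lt (ENNReal.measurable_ofReal.comp measurable_fst)
      ((measurable_delivery hY hS i).comp measurable_snd)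

lemma measurable_runningCost {r : ℝ → ℝ} (hr : Continuous r) (lam b : ℝ)
    (hY : ∀ i, Measurable (Y i)) (hS : ∀ i, Measurable (S i)) :
    Measurable fun z : ℝ × Ω => runningCost r lam b Y S z.1 z.2 := by
  unfold runningCost
  exact ((hr.measurable.comp (measurable_age hY hS)).add
    ((measurable_occupation hY hS).const_mul lam)).sub_const b

lemma intervalIntegrable_runningCost {r : ℝ → ℝ} (hr : Continuous r) (lam b : ℝ)
    (hY : ∀ i, Measurable (Y i)) (hS : ∀ i, Measurable (S i)) (ω : Ω) {s t : ℝ}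
    (hs : 0 ≤ s) (ht : 0 ≤ t) :
    IntervalIntegrable (fun t => runningCost r lam b Y S t ω) volume s t := by
  obtain ⟨B, -, hB⟩ := exists_bound_runningCost (Ω := Ω) hr lam b (max s t)
  rw [intervalIntegrable_iff]
  refine Measure.integrableOn_of_bounded (M := B) (by simp) ?_ ?_
  · exact ((measurable_runningCost hr lam b hY hS).comp
      (measurable_id.prodMk measurable_const)).aestronglyMeasurable
  · refine (ae_restrict_iff' measurableSet_uIoc).2 (ae_of_all _ fun x hx => ?_)
    rw [Set.uIoc, Set.mem_Ioc] at hx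
    exact hB Y S x ω ((le_min hs ht).trans hx.1.le) hx.2

end Paths

/-! ### Pathwise accounting between sampling times, up to a horizon -/

/-- Sampling time `n`, stopped at the horizon `T`. -/
def cut {Ω : Type*} (S : ℕ → Ω → ℝ≥0∞) (T : ℝ) (n : ℕ) (ω : Ω) : ℝ :=
  (min (S n ω) (ENNReal.ofReal T)).toReal

open Classical in
/-- Indicator of the event that sample `n` is taken before the horizon `T`. -/
def taken {Ω : Type*} (S : ℕ → Ω → ℝ≥0∞) (T : ℝ) (n : ℕ) (ω : Ω) : ℝ :=
  if S n ω ≤ ENNReal.ofReal T then 1 else 0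

/-- Age at which sample `n` is taken. -/
def samplingAge {Ω : Type*} (S : ℕ → Ω → ℝ≥0∞) (n : ℕ) (ω : Ω) : ℝ :=
  (S n ω).toReal - (S (n - 1) ω).toReal

/-- Cost of a full service that starts at age `u` and takes time `y`. -/
def serviceCost (r : ℝ → ℝ) (lam b u y : ℝ) : ℝ :=
  prim r (u + y) - prim r u + (lam - b) * y

/-- Relative value of waiting at age `a`. -/
def relValue (r Q : ℝ → ℝ) (b κ a : ℝ) : ℝ := Q a - prim r a + b * a + κ

section Paths

variable {Ω : Type*} {Y : ℕ → Ω → ℝ≥0} {S : ℕ → Ω → ℝ≥0∞}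

lemma cut_of_le {T : ℝ} {n : ℕ} {ω : Ω} (h : S n ω ≤ ENNReal.ofReal T) :
    cut S T n ω = (S n ω).toReal := by
  rw [cut, min_eq_left h]

lemma cut_of_lt {T : ℝ} (hT : 0 ≤ T) {n : ℕ} {ω : Ω} (h : ENNReal.ofReal T < S n ω) :
    cut S T n ω = T := by
  rw [cut, min_eq_right h.le, ENNReal.toReal_ofReal hT]

lemma cut_mem {T : ℝ} (hT : 0 ≤ T) (n : ℕ) (ω : Ω) : cut S T n ω ∈ Set.Icc 0 T := by
  refine ⟨ENNReal.toReal_nonneg, ?_⟩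
  have := ENNReal.toReal_mono ENNReal.ofReal_ne_top (min_le_right (S n ω) (ENNReal.ofReal T))
  rwa [ENNReal.toReal_ofReal hT] at this

lemma cut_mono (hd : ∀ i ω, delivery Y S i ω ≤ S (i + 1) ω) (T : ℝ) (n : ℕ) (ω : Ω) :
    cut S T n ω ≤ cut S T (n + 1) ω := by
  refine ENNReal.toReal_mono (ne_top_of_le_ne_top ENNReal.ofReal_ne_top (min_le_right _ _)) ?_
  exact min_le_min_right _ (sampling_mono hd ω (Nat.le_succ n))

lemma taken_mem (T : ℝ) (n : ℕ) (ω : Ω) : taken S T n ω ∈ Set.Icc (0 : ℝ) 1 := by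
  unfold taken
  split_ifs <;> simp

lemma samplingAge_mem (hd : ∀ i ω, delivery Y S i ω ≤ S (i + 1) ω) {T : ℝ} (hT : 0 ≤ T)
    {n : ℕ} {ω : Ω} (h : S n ω ≤ ENNReal.ofReal T) : samplingAge S n ω ∈ Set.Icc 0 T := by
  have h1 := ENNReal.toReal_mono (ne_top_of_le_ne_top ENNReal.ofReal_ne_top h)
    (sampling_mono hd ω (Nat.sub_le n 1))
  have h2 := ENNReal.toReal_mono ENNReal.ofReal_ne_top h
  rw [ENNReal.toReal_ofReal hT] at h2
  unfold samplingAge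
  constructor
  · simpa using h1
  · linarith [ENNReal.toReal_nonneg (a := S (n - 1) ω)]

lemma toReal_delivery {n : ℕ} {ω : Ω} (h : S n ω ≠ ∞) :
    (delivery Y S n ω).toReal = (S n ω).toReal + Y n ω := by
  rw [delivery, ENNReal.toReal_add h ENNReal.coe_ne_top, ENNReal.coe_toReal]

/-- Pathwise lower bound for the running cost between two sampling times. -/
lemma segment_cost_ge {r Q : ℝ → ℝ} (hr : Continuous r) {lam b κ C K m T : ℝ}
    (h0 : ∀ ω, S 0 ω = 0) (hd : ∀ i ω, delivery Y S i ω ≤ S (i + 1) ω)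
    (hY : ∀ ω s t, 0 ≤ s → 0 ≤ t →
      IntervalIntegrable (fun t => runningCost r lam b Y S t ω) volume s t)
    (hK : 0 ≤ K) (hm : 0 ≤ m) (hT : 0 ≤ T)
    (hV : ∀ a, 0 ≤ a → relValue r Q b κ a ≤ C)
    (hover : ∀ x y, 0 ≤ x → 0 ≤ y → serviceCost r lam b x y ≤ K * y)
    (n : ℕ) (ω : Ω)
    (hQ : ∀ a, S n ω ≠ ∞ → (Y n ω : ℝ) ≤ a → S n ω + ENNReal.ofReal a ≤ S (n + 1) ω →
      Q (Y n ω) ≤ Q a) :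
    taken S T n ω * (serviceCost r lam b (samplingAge S n ω) (Y n ω)
        + relValue r Q b κ (Y n ω) - K * max ((Y n ω : ℝ) - m) 0)
      - taken S T (n + 1) ω * relValue r Q b κ (samplingAge S (n + 1) ω)
      - (C + K * m) * (taken S T n ω - taken S T (n + 1) ω)
    ≤ ∫ t in (cut S T n ω)..(cut S T (n + 1) ω), runningCost r lam b Y S t ω := by
  by_cases hn : S n ω ≤ ENNReal.ofReal T
  swap
  · have hn1 : ENNReal.ofReal T < S (n + 1) ω :=
      (not_le.1 hn).trans_le (sampling_mono hd ω (Nat.le_succ n))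
    rw [cut_of_lt hT (not_le.1 hn), cut_of_lt hT hn1]
    simp [taken, hn, not_le.2 hn1]
  have hfin : S n ω ≠ ∞ := ne_top_of_le_ne_top ENNReal.ofReal_ne_top hn
  set s := (S n ω).toReal with hs
  set y : ℝ := (Y n ω : ℝ) with hy
  have hs0 : 0 ≤ s := ENNReal.toReal_nonneg
  have hy0 : 0 ≤ y := (Y n ω).coe_nonneg
  have hofs : ENNReal.ofReal s = S n ω := ENNReal.ofReal_toReal hfin
  have hofd : ENNReal.ofReal (s + y) = delivery Y S n ω := by
    rw [ENNReal.ofReal_add hs0 hy0, hofs, hy, ENNReal.ofReal_coe_nnreal, delivery]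
  have hsT : s ≤ T := by
    have := ENNReal.toReal_mono ENNReal.ofReal_ne_top hn
    rwa [ENNReal.toReal_ofReal hT] at this
  have hI : taken S T n ω = 1 := if_pos hn
  have hmax : 0 ≤ max (y - m) 0 := le_max_right _ _
  have hVy := hV y hy0
  rw [cut_of_le hn, hI, ← hs]
  by_cases hdT : delivery Y S n ω ≤ ENNReal.ofReal T
  · -- sample delivered before the horizon
    have hsyT : s + y ≤ T := by
      rw [← hofd] at hdT
      exact (ENNReal.ofReal_le_ofReal_iff hT).1 hdT
    obtain ⟨t, ht, hst, htS, htT⟩ : ∃ t, cut S T (n + 1) ω = t ∧ s + y ≤ t ∧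
        ENNReal.ofReal t ≤ S (n + 1) ω ∧ (S (n + 1) ω ≤ ENNReal.ofReal T →
          t = (S (n + 1) ω).toReal) := by
      refine ⟨_, rfl, ?_, ?_, fun h => cut_of_le h⟩
      · rw [cut, ← ENNReal.ofReal_le_iff_le_toReal
          (ne_top_of_le_ne_top ENNReal.ofReal_ne_top (min_le_right _ _)), hofd]
        exact le_min (hd n ω) hdT
      · rw [cut, ENNReal.ofReal_toReal
          (ne_top_of_le_ne_top ENNReal.ofReal_ne_top (min_le_right _ _))]
        exact min_le_left _ _
    rw [ht, ← intervalIntegral.integral_add_adjacent_intervals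
      (hY ω s (s + y) hs0 (by linarith)) (hY ω (s + y) t (by linarith) (by linarith)),
      integral_runningCost_in_service hr lam b h0 hd hs0 (by linarith) hofs.ge hofd.le,
      integral_runningCost_waiting hr lam b hd (by linarith) hst hofd.ge htS, ← hs]
    have hQ' := hQ (t - s) hfin (by linarith) (by
      rw [← hofs, ← ENNReal.ofReal_add hs0 (by linarith)]
      simpa using htS)
    have hage : samplingAge S n ω = s - (S (n - 1) ω).toReal := rfl
    have e1 : s + y - (S (n - 1) ω).toReal = samplingAge S n ω + y := by rw [hage]; ring
    rw [e1, ← hage, show s + y - s = y by ring, show t - (s + y) = (t - s) - y by ring]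
    have hVt : relValue r Q b κ (t - s) ≤ C := hV _ (by linarith)
    have hKm : 0 ≤ K * m := mul_nonneg hK hm
    have hKx : 0 ≤ K * max (y - m) 0 := mul_nonneg hK hmax
    by_cases hn1 : S (n + 1) ω ≤ ENNReal.ofReal T
    · have hI1 : taken S T (n + 1) ω = 1 := if_pos hn1
      have hage1 : samplingAge S (n + 1) ω = t - s := by
        rw [samplingAge, Nat.add_sub_cancel, htT hn1]
      rw [hI1, hage1]
      simp only [relValue, serviceCost] at *
      nlinarith
    -- No further sample before the horizon: the final `relValue (t - s)` is replaced by its upper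
    -- bound `C`.
    · have hI1 : taken S T (n + 1) ω = 0 := if_neg hn1
      rw [hI1]
      simp only [relValue, serviceCost] at *
      nlinarith
  · -- sample in service at the horizon
    have hTd := not_le.1 hdT
    have hn1 : ENNReal.ofReal T < S (n + 1) ω := hTd.trans_le (hd n ω)
    have hI1 : taken S T (n + 1) ω = 0 := if_neg (not_le.2 hn1)
    rw [hI1, cut_of_lt hT hn1,
      integral_runningCost_in_service hr lam b h0 hd hs0 hsT hofs.ge hTd.le]
    have hTy : T < s + y := by
      rw [← hofd] at hTd
      exact (ENNReal.ofReal_lt_ofReal_iff_of_nonneg hT).1 hTd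
    have hu := samplingAge_mem hd hT hn
    have hage : samplingAge S n ω = s - (S (n - 1) ω).toReal := rfl
    rw [← hage, show T - (S (n - 1) ω).toReal = samplingAge S n ω + (T - s) by rw [hage]; ring]
    -- The interrupted service is charged in full. The part beyond `T` costs at most `K * (s + y -
    -- T) ≤ K * y`, and `y` is split at `m` so that only the excess over `m` appears for each
    -- sample.
    have ho := hover (samplingAge S n ω + (T - s)) (s + y - T) (by linarith [hu.1]) (by linarith)
    rw [serviceCost, show samplingAge S n ω + (T - s) + (s + y - T) = samplingAge S n ω + y by
      ring] at ho
    have h3 : K * (s + y - T) ≤ K * m + K * max (y - m) 0 := by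
      rw [← mul_add]
      exact mul_le_mul_of_nonneg_left (by linarith [le_max_left (y - m) 0]) hK
    simp only [serviceCost]
    nlinarith

/-- Services are disjoint in time. Cut to length at most `1`, those that begin by time `T` fit into
`[0, T + 1]`. -/
lemma sum_taken_mul_min_le (hd : ∀ i ω, delivery Y S i ω ≤ S (i + 1) ω) {T : ℝ} (hT : 0 ≤ T)
    (ω : Ω) (N : ℕ) :
    ∑ n ∈ Finset.range N, taken S T n ω * min (Y n ω : ℝ) 1 ≤ cut S (T + 1) N ω := by
  induction N with
  | zero => simp [cut]
  | succ N ih =>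
    rw [Finset.sum_range_succ]
    by_cases hN : S N ω ≤ ENNReal.ofReal T
    · have hfin : S N ω ≠ ∞ := ne_top_of_le_ne_top ENNReal.ofReal_ne_top hN
      have hN' : S N ω ≤ ENNReal.ofReal (T + 1) :=
        hN.trans (ENNReal.ofReal_le_ofReal (by linarith))
      have h2 := ENNReal.toReal_mono ENNReal.ofReal_ne_top hN
      rw [ENNReal.toReal_ofReal hT] at h2
      rw [cut_of_le hN'] at ih
      have hy0 : (0 : ℝ) ≤ Y N ω := (Y N ω).coe_nonneg
      have h3 : (S N ω).toReal + min (Y N ω : ℝ) 1 ≤ cut S (T + 1) (N + 1) ω := by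
        rw [cut, ← ENNReal.ofReal_le_iff_le_toReal
          (ne_top_of_le_ne_top ENNReal.ofReal_ne_top (min_le_right _ _))]
        refine le_min (le_trans ?_ (hd N ω)) (ENNReal.ofReal_le_ofReal ?_)
        · rw [ENNReal.ofReal_add ENNReal.toReal_nonneg (by positivity),
            ENNReal.ofReal_toReal hfin, delivery]
          gcongr
          refine (ENNReal.ofReal_le_ofReal (min_le_left _ _)).trans ?_
          rw [ENNReal.ofReal_coe_nnreal]
        · linarith [min_le_right (Y N ω : ℝ) 1]
      rw [taken, if_pos hN, one_mul]
      linarith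
    · rw [taken, if_neg hN, zero_mul, add_zero]
      exact ih.trans (cut_mono hd _ _ _)

end Paths

/-! ### Independence of sampling decisions and transmission times -/

lemma integral_comp_of_indepFun {Ω α β : Type*} [MeasurableSpace Ω] [MeasurableSpace α]
    [MeasurableSpace β] {P : Measure Ω} [IsProbabilityMeasure P] {X : Ω → α} {Z : Ω → β}
    (hX : Measurable X) (hZ : Measurable Z) (h : IndepFun X Z P) {f : α × β → ℝ}
    (hf : Measurable f) (hint : Integrable (fun ω => f (X ω, Z ω)) P) :
    Integrable (fun ω => ∫ z, f (X ω, z) ∂(P.map Z)) P ∧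
      ∫ ω, f (X ω, Z ω) ∂P = ∫ ω, ∫ z, f (X ω, z) ∂(P.map Z) ∂P := by
  have hm := (indepFun_iff_map_prod_eq_prod_map_map hX.aemeasurable hZ.aemeasurable).1 h
  have := Measure.isProbabilityMeasure_map (μ := P) hX.aemeasurable
  have := Measure.isProbabilityMeasure_map (μ := P) hZ.aemeasurable
  have hi : Integrable f ((P.map X).prod (P.map Z)) := by
    rw [← hm]
    exact (integrable_map_measure hf.aestronglyMeasurable (hX.prodMk hZ).aemeasurable).2 hint
  refine ⟨?_, ?_⟩
  · exact (integrable_map_measure hi.integral_prod_left.aestronglyMeasurable hX.aemeasurable).1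
      hi.integral_prod_left
  · calc ∫ ω, f (X ω, Z ω) ∂P = ∫ z, f z ∂(P.map fun ω => (X ω, Z ω)) :=
        (integral_map (hX.prodMk hZ).aemeasurable hf.aestronglyMeasurable).symm
      _ = _ := by
        rw [hm, integral_prod _ hi,
          integral_map hX.aemeasurable hi.integral_prod_left.aestronglyMeasurable]

/-- The law of the transmission times. -/
def law {Ω : Type*} [MeasurableSpace Ω] (P : Measure Ω) (Y : ℕ → Ω → ℝ≥0) : Measure ℝ :=
  P.map fun ω => (Y 0 ω : ℝ)

section Stochastic

variable {Ω : Type*} [MeasurableSpace Ω] {P : Measure Ω} [IsProbabilityMeasure P]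
  {Y : ℕ → Ω → ℝ≥0} {S : ℕ → Ω → ℝ≥0∞}

lemma isProbabilityMeasure_law (hY : ∀ i, Measurable (Y i)) : IsProbabilityMeasure (law P Y) :=
  Measure.isProbabilityMeasure_map (hY 0).coe_nnreal_real.aemeasurable

lemma map_eq_law (hident : ∀ i, IdentDistrib (Y i) (Y 0) P P) (n : ℕ) :
    P.map (fun ω => (Y n ω : ℝ)) = law P Y :=
  ((hident n).comp measurable_coe_nnreal_real).map_eq

lemma ae_law_nonneg (hY : ∀ i, Measurable (Y i)) : ∀ᵐ y ∂(law P Y), 0 ≤ y := by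
  rw [law, ae_map_iff (hY 0).coe_nnreal_real.aemeasurable measurableSet_Ici]
  exact ae_of_all _ fun ω => (Y 0 ω).coe_nonneg

lemma integrable_comp_transmission (hY : ∀ i, Measurable (Y i))
    (hident : ∀ i, IdentDistrib (Y i) (Y 0) P P) {g : ℝ → ℝ} (hg : Integrable g (law P Y))
    (n : ℕ) : Integrable (fun ω => g (Y n ω)) P := by
  rw [← map_eq_law hident n] at hg
  exact (integrable_map_measure hg.aestronglyMeasurable (hY n).coe_nnreal_real.aemeasurable).1 hg

lemma integral_comp_transmission (hY : ∀ i, Measurable (Y i))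
    (hident : ∀ i, IdentDistrib (Y i) (Y 0) P P) {g : ℝ → ℝ} (hg : Measurable g)
    (n : ℕ) : ∫ ω, g (Y n ω) ∂P = ∫ y, g y ∂(law P Y) := by
  rw [← map_eq_law hident n]
  exact (integral_map (hY n).coe_nnreal_real.aemeasurable hg.aestronglyMeasurable).symm

/-- Both sampling times are measurable for the history before sample `n`, and `Y n` belongs to its
future. For `n = 0` they are constant. -/
lemma indepFun_sampling_transmission (hS : IsCausal P Y S) (n : ℕ) :
    IndepFun (fun ω => (S (n - 1) ω, S n ω)) (fun ω => (Y n ω : ℝ)) P := by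
  rcases n with _ | n
  · have : (fun ω => (S (0 - 1) ω, S 0 ω)) = fun _ => ((0 : ℝ≥0∞), (0 : ℝ≥0∞)) := by
      funext ω
      simp [hS.zero ω]
    rw [this]
    exact indepFun_const_left _ _
  · rw [IndepFun_iff_Indep]
    refine indep_of_indep_of_le_left (indep_of_indep_of_le_right (hS.causal n) ?_) ?_
    · have h1 : MeasurableSpace.comap (fun ω => (Y (n + 1) ω : ℝ)) inferInstance ≤
          MeasurableSpace.comap (Y (n + 1)) inferInstance := by
        rw [show (fun ω => (Y (n + 1) ω : ℝ)) = (fun x : ℝ≥0 => (x : ℝ)) ∘ Y (n + 1) from rfl,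
          ← MeasurableSpace.comap_comp]
        exact MeasurableSpace.comap_mono measurable_coe_nnreal_real.comap_le
      exact h1.trans (le_iSup₂_of_le (f := fun j (_ : j > n) =>
        MeasurableSpace.comap (Y j) inferInstance) (n + 1) (Nat.lt_succ_self n) le_rfl)
    · rw [← measurable_iff_comap_le]
      have h2 : ∀ j ≤ n + 1, @Measurable _ _ (history Y S n) _ (S j) := fun j hj => by
        rw [measurable_iff_comap_le]
        exact le_sup_of_le_right (le_iSup₂_of_le (f := fun j (_ : j ≤ n + 1) =>
          MeasurableSpace.comap (S j) inferInstance) j hj le_rfl)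
      exact (h2 _ (by omega)).prodMk (h2 _ le_rfl)

lemma measurable_taken (hS : ∀ i, Measurable (S i)) (T : ℝ) (n : ℕ) :
    Measurable (taken S T n) := by
  unfold taken
  exact Measurable.ite (measurableSet_le (hS n) measurable_const) measurable_const
    measurable_const

lemma measurable_samplingAge (hS : ∀ i, Measurable (S i)) (n : ℕ) :
    Measurable (samplingAge S n) := by
  unfold samplingAge
  exact (hS n).ennreal_toReal.sub (hS (n - 1)).ennreal_toReal

lemma integrable_taken (hS : ∀ i, Measurable (S i)) (T : ℝ) (n : ℕ) :
    Integrable (taken S T n) P :=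
  Integrable.of_bound (measurable_taken hS T n).aestronglyMeasurable 1
    (ae_of_all _ fun ω => by
      rw [Real.norm_eq_abs, abs_of_nonneg (taken_mem T n ω).1]
      exact (taken_mem T n ω).2)

lemma integrable_taken_mul (hS : ∀ i, Measurable (S i)) (T : ℝ) (n : ℕ) {g : Ω → ℝ}
    (hg : Integrable g P) : Integrable (fun ω => taken S T n ω * g ω) P :=
  hg.bdd_mul (measurable_taken hS T n).aestronglyMeasurable (c := 1)
    (ae_of_all _ fun ω => by
      rw [Real.norm_eq_abs, abs_of_nonneg (taken_mem T n ω).1]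
      exact (taken_mem T n ω).2)

/-- The decision to take sample `n` before the horizon is independent of its transmission time. -/
lemma integral_taken_mul (hY : ∀ i, Measurable (Y i)) (hident : ∀ i, IdentDistrib (Y i) (Y 0) P P)
    (hS : IsCausal P Y S) (T : ℝ) (n : ℕ) {g : ℝ → ℝ} (hg : Measurable g) :
    ∫ ω, taken S T n ω * g (Y n ω) ∂P = (∫ ω, taken S T n ω ∂P) * ∫ y, g y ∂(law P Y) := by
  have h1 : IndepFun (taken S T n) (fun ω => g (Y n ω)) P := by
    have hφ : Measurable fun x : ℝ≥0∞ × ℝ≥0∞ =>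
        (if x.2 ≤ ENNReal.ofReal T then (1 : ℝ) else 0) :=
      Measurable.ite (measurableSet_le measurable_snd measurable_const) measurable_const
        measurable_const
    have := (indepFun_sampling_transmission hS n).comp hφ hg
    refine this.congr (ae_of_all _ fun ω => ?_) (ae_of_all _ fun ω => rfl)
    simp [taken]
  rw [h1.integral_fun_mul_eq_mul_integral
    (measurable_taken hS.measurable T n).aestronglyMeasurable
    (hg.comp (hY n).coe_nnreal_real).aestronglyMeasurable,
    integral_comp_transmission hY hident hg]

lemma measurable_serviceCost {r : ℝ → ℝ} (hr : Continuous r) (lam b : ℝ) :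
    Measurable fun z : ℝ × ℝ => serviceCost r lam b z.1 z.2 := by
  have := continuous_prim hr
  unfold serviceCost
  exact Continuous.measurable (by fun_prop)

lemma abs_prim_sub_le {r : ℝ → ℝ} (hr : Continuous r) {u y T : ℝ} (hu : 0 ≤ u) (huT : u ≤ T)
    (hy : 0 ≤ y) : |prim r (u + y) - prim r u| ≤ prim (fun s => |r s|) (T + y) := by
  rw [← integral_eq_prim_sub hr]
  refine (intervalIntegral.abs_integral_le_integral_abs (by linarith)).trans ?_
  unfold prim
  exact intervalIntegral.integral_mono_interval hu (by linarith) (by linarith)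
    (ae_of_all _ fun s => abs_nonneg _) (hr.abs.intervalIntegrable _ _)

/-- Expected number of samples taken before the horizon. -/
lemma sum_integral_taken_le (hY : ∀ i, Measurable (Y i))
    (hident : ∀ i, IdentDistrib (Y i) (Y 0) P P) (hS : IsCausal P Y S) {T : ℝ} (hT : 0 ≤ T)
    (N : ℕ) :
    (∑ n ∈ Finset.range N, ∫ ω, taken S T n ω ∂P) * ∫ y, min y 1 ∂(law P Y) ≤ T + 1 := by
  have := isProbabilityMeasure_law (P := P) hY
  have hg : Measurable fun y : ℝ => min y 1 := measurable_id.min measurable_const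
  have hi : Integrable (fun y : ℝ => min y 1) (law P Y) := by
    refine Integrable.of_bound hg.aestronglyMeasurable 1 ?_
    filter_upwards [ae_law_nonneg (P := P) hY] with y hy
    rw [Real.norm_eq_abs, abs_of_nonneg (by positivity)]
    exact min_le_right _ _
  rw [Finset.sum_mul]
  simp_rw [← integral_taken_mul hY hident hS T _ hg]
  rw [← integral_finsetSum _ fun n _ => integrable_taken_mul hS.measurable T n
    (integrable_comp_transmission hY hident hi n)]
  calc _ ≤ ∫ _, (T + 1) ∂P := by
        refine integral_mono (integrable_finsetSum _ fun n _ =>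
          integrable_taken_mul hS.measurable T n
            (integrable_comp_transmission hY hident hi n)) (integrable_const _) fun ω => ?_
        exact (sum_taken_mul_min_le hS.delivery_le hT ω N).trans (cut_mem (by linarith) N ω).2
    _ = T + 1 := by simp

end Stochastic

/-! ### Certificates and the Bellman inequalities in expectation -/

section Verification

variable {Ω : Type*} [MeasurableSpace Ω] {P : Measure Ω} [IsProbabilityMeasure P]
  {Y : ℕ → Ω → ℝ≥0} {S : ℕ → Ω → ℝ≥0∞}

lemma integrable_law_id (hY : ∀ i, Measurable (Y i))
    (hint : Integrable (fun ω => (Y 0 ω : ℝ)) P) : Integrable (fun y => y) (law P Y) :=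
  (integrable_map_measure measurable_id.aestronglyMeasurable
    (hY 0).coe_nnreal_real.aemeasurable).2 hint

lemma integral_law_id (hY : ∀ i, Measurable (Y i)) :
    ∫ y, y ∂(law P Y) = ∫ ω, (Y 0 ω : ℝ) ∂P :=
  integral_map (hY 0).coe_nnreal_real.aemeasurable measurable_id.aestronglyMeasurable

/-- A zero integral would force `min y 1 = 0`, hence `y = 0`, almost surely. Positivity bounds the
expected number of samples per unit of time. -/
lemma integral_min_one_pos {ν : Measure ℝ} [IsProbabilityMeasure ν] (h0 : ∀ᵐ y ∂ν, 0 ≤ y)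
    (hpos : 0 < ∫ y, y ∂ν) : 0 < ∫ y, min y 1 ∂ν := by
  have hnn : 0 ≤ᵐ[ν] fun y : ℝ => min y 1 := by
    filter_upwards [h0] with y hy
    exact le_min hy zero_le_one
  refine lt_of_le_of_ne (integral_nonneg_of_ae hnn) fun h => ?_
  have hi : Integrable (fun y : ℝ => min y 1) ν := by
    refine Integrable.of_bound (measurable_id.min measurable_const).aestronglyMeasurable 1 ?_
    filter_upwards [h0] with y hy
    rw [Real.norm_eq_abs, abs_of_nonneg (by positivity)]
    exact min_le_right _ _
  have h1 := (integral_eq_zero_iff_of_nonneg_ae hnn hi).1 h.symm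
  have h2 : (fun y : ℝ => y) =ᵐ[ν] fun _ => 0 := by
    filter_upwards [h1] with y hy
    simp only [Pi.zero_apply] at hy
    rcases min_choice y 1 with h | h
    · rwa [h] at hy
    · rw [h] at hy
      norm_num at hy
  rw [integral_congr_ae h2] at hpos
  simp at hpos

/-- This makes the charge for long services cut by the horizon negligible per sample; integrability
of `y` suffices, no second moment is needed. -/
lemma tendsto_integral_excess {ν : Measure ℝ} (hint : Integrable (fun y => y) ν) :
    Tendsto (fun m : ℕ => ∫ y, max (y - m) 0 ∂ν) atTop (nhds 0) := by
  have h := tendsto_integral_of_dominated_convergence (μ := ν) (f := fun _ => (0 : ℝ))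
    (F := fun (m : ℕ) (y : ℝ) => max (y - m) 0) (fun y => |y|)
    (fun m => ((measurable_id.sub_const _).max measurable_const).aestronglyMeasurable)
    hint.abs (fun m => ae_of_all _ fun y => ?_) (ae_of_all _ fun y => ?_)
  · simpa using h
  · rw [Real.norm_eq_abs, abs_of_nonneg (le_max_right _ _)]
    exact max_le (by linarith [le_abs_self y, Nat.cast_nonneg (α := ℝ) m]) (abs_nonneg _)
  · refine tendsto_const_nhds.congr' ?_
    filter_upwards [eventually_ge_atTop ⌈y⌉₊] with m hm
    rw [max_eq_right]
    linarith [Nat.ceil_le.1 hm]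

/-- Hypotheses under which `b` bounds the average cost of the policy `S` from below, for a rate
function `r` and an activation cost `lam`. The function `Q` is the candidate for the optimal value
of waiting, up to the normalisation in `relValue`. -/
structure Certificate (P : Measure Ω) (Y : ℕ → Ω → ℝ≥0) (S : ℕ → Ω → ℝ≥0∞)
    (r Q : ℝ → ℝ) (lam b : ℝ) : Prop where
  cont : Continuous r
  meas : Measurable Q
  bdd : ∀ T, ∃ B, ∀ a ∈ Set.Icc 0 T, |Q a| ≤ B
  upper : ∃ C, ∀ a, 0 ≤ a → relValue r Q b ((lam - b) * ∫ y, y ∂(law P Y)) a ≤ C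
  overshoot : ∃ K, 0 ≤ K ∧ ∀ x y, 0 ≤ x → 0 ≤ y → serviceCost r lam b x y ≤ K * y
  integrable_rate : ∀ T, 0 ≤ T → Integrable (fun y => prim (fun s => |r s|) (T + y)) (law P Y)
  wait : ∀ n ω a, S n ω ≠ ∞ → (Y n ω : ℝ) ≤ a → S n ω + ENNReal.ofReal a ≤ S (n + 1) ω →
    Q (Y n ω) ≤ Q a
  sample : ∀ n ω, S (n + 1) ω ≠ ∞ → Q (samplingAge S (n + 1) ω) ≤
    ∫ y, prim r (samplingAge S (n + 1) ω + y) ∂(law P Y) - b * samplingAge S (n + 1) ω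
  integrable_value : Integrable (relValue r Q b ((lam - b) * ∫ y, y ∂(law P Y))) (law P Y)
  value_nonneg : 0 ≤ ∫ a, relValue r Q b ((lam - b) * ∫ y, y ∂(law P Y)) a ∂(law P Y)

variable {r Q : ℝ → ℝ} {lam b : ℝ}

lemma Certificate.integrable_prim_add (hY : ∀ i, Measurable (Y i))
    (hc : Certificate P Y S r Q lam b) {u : ℝ} (hu : 0 ≤ u) :
    Integrable (fun y => prim r (u + y) - prim r u) (law P Y) := by
  refine (hc.integrable_rate u hu).mono' ?_ ?_
  · have := continuous_prim hc.cont
    exact Continuous.aestronglyMeasurable (by fun_prop)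
  · filter_upwards [ae_law_nonneg (P := P) hY] with y hy
    exact abs_prim_sub_le hc.cont hu le_rfl hy

/-- The Bellman inequality for sampling at once: the field `sample` bounds `Q`, and the constant
`(lam - b) E Y` in `relValue` is exactly the activation cost minus the reward over the coming
service. -/
lemma Certificate.relValue_le (hY : ∀ i, Measurable (Y i))
    (hint : Integrable (fun ω => (Y 0 ω : ℝ)) P) (hS : IsCausal P Y S)
    (hc : Certificate P Y S r Q lam b) (n : ℕ) (ω : Ω) (h : S (n + 1) ω ≠ ∞) :
    relValue r Q b ((lam - b) * ∫ y, y ∂(law P Y)) (samplingAge S (n + 1) ω) ≤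
      ∫ y, serviceCost r lam b (samplingAge S (n + 1) ω) y ∂(law P Y) := by
  have := isProbabilityMeasure_law (P := P) hY
  have hu : 0 ≤ samplingAge S (n + 1) ω := by
    rw [samplingAge, sub_nonneg]
    exact ENNReal.toReal_mono h (sampling_mono hS.delivery_le ω (Nat.sub_le _ _))
  have h1 := hc.sample n ω h
  set u := samplingAge S (n + 1) ω
  have hi := hc.integrable_prim_add hY hu
  have hi' : Integrable (fun y => prim r (u + y)) (law P Y) := by
    exact (hi.add (integrable_const (prim r u))).congr (ae_of_all _ fun y => by simp)
  simp only [serviceCost]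
  rw [integral_add hi ((integrable_law_id hY hint).const_mul _), integral_sub hi'
    (integrable_const _), integral_const_mul]
  simp only [relValue, integral_const, probReal_univ, one_smul]
  linarith

/-- A sample taken before `T` has age at most `T`, so the increment of `prim r` during its service
is dominated by `prim |r| (T + Y n)`. -/
lemma Certificate.integrable_service (hY : ∀ i, Measurable (Y i))
    (hident : ∀ i, IdentDistrib (Y i) (Y 0) P P)
    (hint : Integrable (fun ω => (Y 0 ω : ℝ)) P) (hS : IsCausal P Y S)
    (hc : Certificate P Y S r Q lam b) {T : ℝ} (hT : 0 ≤ T) (n : ℕ) :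
    Integrable (fun ω => taken S T n ω * serviceCost r lam b (samplingAge S n ω) (Y n ω)) P := by
  have h1 := integrable_comp_transmission hY hident
    ((hc.integrable_rate T hT).add ((integrable_law_id hY hint).const_mul |lam - b|)) n
  refine h1.mono' ?_ (ae_of_all _ fun ω => ?_)
  · exact ((measurable_taken hS.measurable T n).mul
      ((measurable_serviceCost hc.cont lam b).comp
        ((measurable_samplingAge hS.measurable n).prodMk
          (hY n).coe_nnreal_real))).aestronglyMeasurable
  · have hy : (0 : ℝ) ≤ Y n ω := (Y n ω).coe_nonneg
    rw [taken]
    split_ifs with h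
    · have hu := samplingAge_mem hS.delivery_le hT h
      have h2 := abs_prim_sub_le hc.cont hu.1 hu.2 hy
      rw [one_mul, Real.norm_eq_abs, serviceCost]
      refine (abs_add_le _ _).trans ?_
      rw [abs_mul, abs_of_nonneg hy]
      simpa using h2
    · rw [zero_mul, norm_zero]
      have : 0 ≤ prim (fun s => |r s|) (T + Y n ω) :=
        intervalIntegral.integral_nonneg (by linarith) fun s _ => abs_nonneg _
      simp only [Pi.add_apply]
      positivity

lemma Certificate.exists_bound_relValue (hc : Certificate P Y S r Q lam b) (T : ℝ) :
    ∃ B, ∀ a ∈ Set.Icc 0 T, |relValue r Q b ((lam - b) * ∫ y, y ∂(law P Y)) a| ≤ B := by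
  obtain ⟨B, hB⟩ := hc.bdd T
  have hp := continuous_prim hc.cont
  have hcont : Continuous fun a => - prim r a + b * a + (lam - b) * ∫ y, y ∂(law P Y) := by
    fun_prop
  obtain ⟨B', hB'⟩ := (isCompact_Icc (a := (0 : ℝ)) (b := T)).exists_bound_of_continuousOn
    hcont.continuousOn
  refine ⟨B + B', fun a ha => ?_⟩
  have h1 := hB' a ha
  rw [Real.norm_eq_abs] at h1
  have h2 := abs_add_le (Q a) (- prim r a + b * a + (lam - b) * ∫ y, y ∂(law P Y))
  have h3 : relValue r Q b ((lam - b) * ∫ y, y ∂(law P Y)) a =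
      Q a + (- prim r a + b * a + (lam - b) * ∫ y, y ∂(law P Y)) := by
    rw [relValue]
    ring
  rw [h3]
  linarith [hB a ha]

lemma Certificate.measurable_relValue (hc : Certificate P Y S r Q lam b) :
    Measurable (relValue r Q b ((lam - b) * ∫ y, y ∂(law P Y))) := by
  have := (continuous_prim hc.cont).measurable
  have := hc.meas
  unfold relValue
  fun_prop

lemma Certificate.integrable_taken_relValue (hS : IsCausal P Y S)
    (hc : Certificate P Y S r Q lam b) {T : ℝ} (hT : 0 ≤ T) (n : ℕ) :
    Integrable (fun ω => taken S T n ω *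
      relValue r Q b ((lam - b) * ∫ y, y ∂(law P Y)) (samplingAge S n ω)) P := by
  obtain ⟨B, hB⟩ := hc.exists_bound_relValue T
  refine Integrable.of_bound ((measurable_taken hS.measurable T n).mul
    (hc.measurable_relValue.comp (measurable_samplingAge hS.measurable n))).aestronglyMeasurable
    |B| (ae_of_all _ fun ω => ?_)
  rw [taken]
  split_ifs with h
  · rw [one_mul, Real.norm_eq_abs]
    exact (hB _ (samplingAge_mem hS.delivery_le hT h)).trans (le_abs_self B)
  · simp

/-- Given the sampling times up to `S (n + 1)`, the transmission time `Y (n + 1)` still has law `ν`.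
Integrating it out reduces the claim to `relValue_le` at the realised age. -/
lemma Certificate.integral_taken_relValue_le (hY : ∀ i, Measurable (Y i))
    (hident : ∀ i, IdentDistrib (Y i) (Y 0) P P)
    (hint : Integrable (fun ω => (Y 0 ω : ℝ)) P) (hS : IsCausal P Y S)
    (hc : Certificate P Y S r Q lam b) {T : ℝ} (hT : 0 ≤ T) (n : ℕ) :
    ∫ ω, taken S T (n + 1) ω *
        relValue r Q b ((lam - b) * ∫ y, y ∂(law P Y)) (samplingAge S (n + 1) ω) ∂P ≤
      ∫ ω, taken S T (n + 1) ω *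
        serviceCost r lam b (samplingAge S (n + 1) ω) (Y (n + 1) ω) ∂P := by
  let f : (ℝ≥0∞ × ℝ≥0∞) × ℝ → ℝ := fun z =>
    (if z.1.2 ≤ ENNReal.ofReal T then 1 else 0) *
      serviceCost r lam b (z.1.2.toReal - z.1.1.toReal) z.2
  have hf : Measurable f := by
    refine (Measurable.ite (measurableSet_le (by fun_prop) measurable_const) measurable_const
      measurable_const).mul ?_
    exact (measurable_serviceCost hc.cont lam b).comp (f := fun z : (ℝ≥0∞ × ℝ≥0∞) × ℝ =>
      (z.1.2.toReal - z.1.1.toReal, z.2)) (by fun_prop)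
  have hfe : ∀ ω y, f ((S (n + 1 - 1) ω, S (n + 1) ω), y) =
      taken S T (n + 1) ω * serviceCost r lam b (samplingAge S (n + 1) ω) y := by
    intro ω y
    simp only [f, taken, samplingAge]
  have hi := hc.integrable_service hY hident hint hS hT (n + 1)
  obtain ⟨h1, h2⟩ := integral_comp_of_indepFun
    ((hS.measurable (n + 1 - 1)).prodMk (hS.measurable (n + 1)))
    (hY (n + 1)).coe_nnreal_real (indepFun_sampling_transmission hS (n + 1)) hf
    (by simpa only [hfe] using hi)
  simp only [hfe, map_eq_law hident, integral_const_mul] at h1 h2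
  rw [h2]
  refine integral_mono (hc.integrable_taken_relValue hS hT (n + 1)) h1 fun ω => ?_
  simp only [taken]
  split_ifs with h
  · rw [one_mul, one_mul]
    exact hc.relValue_le hY hint hS n ω (ne_top_of_le_ne_top ENNReal.ofReal_ne_top h)
  · simp

end Verification

/-! ### The verification theorem -/

section Verification

variable {Ω : Type*} [MeasurableSpace Ω] {P : Measure Ω} [IsProbabilityMeasure P]
  {Y : ℕ → Ω → ℝ≥0} {S : ℕ → Ω → ℝ≥0∞} {r Q : ℝ → ℝ} {lam b : ℝ}

lemma integrable_integral_runningCost (hr : Continuous r) (lam b : ℝ)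
    (hY : ∀ i, Measurable (Y i)) (hS : ∀ i, Measurable (S i)) {T : ℝ} (hT : 0 ≤ T) :
    Integrable (fun ω => ∫ t in (0 : ℝ)..T, runningCost r lam b Y S t ω) P := by
  obtain ⟨B, hB0, hB⟩ := exists_bound_runningCost (Ω := Ω) hr lam b T
  refine Integrable.of_bound (C := B * T) ?_ (ae_of_all _ fun ω => ?_)
  · simp_rw [intervalIntegral.integral_of_le hT]
    have hm : StronglyMeasurable fun z : Ω × ℝ => runningCost r lam b Y S z.2 z.1 :=
      ((measurable_runningCost hr lam b hY hS).comp measurable_swap).stronglyMeasurable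
    exact hm.integral_prod_right'.aestronglyMeasurable
  · have := intervalIntegral.norm_integral_le_of_norm_le_const (a := 0) (b := T) (C := B)
      (f := fun t => runningCost r lam b Y S t ω) fun t ht => by
        rw [Set.uIoc_of_le hT] at ht
        exact hB Y S t ω ht.1.le ht.2
    simpa [abs_of_nonneg hT] using this

/-- Lower bound for the cost up to the horizon, for a single trajectory. -/
lemma sum_segment_le (hr : Continuous r) {κ C K m T B : ℝ} (hY : ∀ i, Measurable (Y i))
    (hS : IsCausal P Y S) (hK : 0 ≤ K) (hm : 0 ≤ m) (hT : 0 ≤ T)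
    (hV : ∀ a, 0 ≤ a → relValue r Q b κ a ≤ C)
    (hover : ∀ x y, 0 ≤ x → 0 ≤ y → serviceCost r lam b x y ≤ K * y)
    (hQ : ∀ n ω a, S n ω ≠ ∞ → (Y n ω : ℝ) ≤ a → S n ω + ENNReal.ofReal a ≤ S (n + 1) ω →
      Q (Y n ω) ≤ Q a)
    (hB0 : 0 ≤ B) (hB : ∀ t ω, 0 ≤ t → t ≤ T → |runningCost r lam b Y S t ω| ≤ B)
    (N : ℕ) (ω : Ω) :
    ∑ n ∈ Finset.range N, (taken S T n ω * serviceCost r lam b (samplingAge S n ω) (Y n ω)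
        + taken S T n ω * (relValue r Q b κ (Y n ω) - K * max ((Y n ω : ℝ) - m) 0)
        - taken S T (n + 1) ω * relValue r Q b κ (samplingAge S (n + 1) ω))
      - (C + K * m) * (1 - taken S T N ω) - B * T * taken S T N ω
    ≤ ∫ t in (0 : ℝ)..T, runningCost r lam b Y S t ω := by
  have hii : ∀ ω s t, 0 ≤ s → 0 ≤ t →
      IntervalIntegrable (fun t => runningCost r lam b Y S t ω) volume s t :=
    fun ω s t hs ht => intervalIntegrable_runningCost hr lam b hY hS.measurable ω hs ht
  have h1 := Finset.sum_le_sum fun n (_ : n ∈ Finset.range N) =>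
    segment_cost_ge hr hS.zero hS.delivery_le hii hK hm hT hV hover n ω fun a => hQ n ω a
  rw [intervalIntegral.sum_integral_adjacent_intervals fun n _ =>
    hii ω _ _ (cut_mem hT n ω).1 (cut_mem hT (n + 1) ω).1] at h1
  have h2 : ∑ n ∈ Finset.range N, (taken S T n ω - taken S T (n + 1) ω) = 1 - taken S T N ω := by
    rw [Finset.sum_range_sub']
    simp [taken, hS.zero ω]
  have hc0 : cut S T 0 ω = 0 := by simp [cut, hS.zero ω]
  -- The time after the `N`-th sampling is bounded crudely. This costs something only if sample `N`
  -- is taken before `T`, an event whose probability tends to zero as `N → ∞`.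
  have h3 : ∫ t in (cut S T N ω)..T, runningCost r lam b Y S t ω ≥ - (B * T * taken S T N ω) := by
    by_cases hN : S N ω ≤ ENNReal.ofReal T
    · have h4 := intervalIntegral.norm_integral_le_of_norm_le_const (a := cut S T N ω) (b := T)
        (C := B) (f := fun t => runningCost r lam b Y S t ω) fun t ht => by
          rw [Set.uIoc_of_le (cut_mem hT N ω).2] at ht
          exact hB t ω ((cut_mem hT N ω).1.trans ht.1.le) ht.2
      rw [Real.norm_eq_abs, abs_of_nonneg (show 0 ≤ T - cut S T N ω from
        sub_nonneg.2 (cut_mem hT N ω).2)] at h4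
      have h5 : B * (T - cut S T N ω) ≤ B * T :=
        mul_le_mul_of_nonneg_left (by linarith [(cut_mem (S := S) hT N ω).1]) hB0
      rw [taken, if_pos hN]
      linarith [neg_le_of_abs_le (h4.trans h5)]
    · rw [cut_of_lt hT (not_le.1 hN)]
      simp [taken, hN]
  rw [hc0] at h1
  rw [← intervalIntegral.integral_add_adjacent_intervals (hii ω 0 (cut S T N ω) le_rfl
    (cut_mem hT N ω).1) (hii ω _ _ (cut_mem hT N ω).1 hT)]
  rw [Finset.sum_sub_distrib, ← Finset.mul_sum, h2] at h1
  have h6 : ∀ n, taken S T n ω * (serviceCost r lam b (samplingAge S n ω) (Y n ω)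
        + relValue r Q b κ (Y n ω) - K * max ((Y n ω : ℝ) - m) 0)
      - taken S T (n + 1) ω * relValue r Q b κ (samplingAge S (n + 1) ω) =
      taken S T n ω * serviceCost r lam b (samplingAge S n ω) (Y n ω)
        + taken S T n ω * (relValue r Q b κ (Y n ω) - K * max ((Y n ω : ℝ) - m) 0)
        - taken S T (n + 1) ω * relValue r Q b κ (samplingAge S (n + 1) ω) := fun n => by ring
  simp only [h6] at h1
  linarith

lemma integral_taken_nonneg (T : ℝ) (n : ℕ) : 0 ≤ ∫ ω, taken S T n ω ∂P :=
  integral_nonneg fun ω => (taken_mem T n ω).1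

/-- Only finitely many samples are taken before the horizon. -/
lemma tendsto_integral_taken (hY : ∀ i, Measurable (Y i))
    (hident : ∀ i, IdentDistrib (Y i) (Y 0) P P) (hpos : 0 < ∫ ω, (Y 0 ω : ℝ) ∂P)
    (hS : IsCausal P Y S) {T : ℝ} (hT : 0 ≤ T) :
    Tendsto (fun n => ∫ ω, taken S T n ω ∂P) atTop (nhds 0) := by
  have := isProbabilityMeasure_law (P := P) hY
  have hμ := integral_min_one_pos (ae_law_nonneg (P := P) hY)
    (by rwa [integral_law_id hY])
  exact (summable_of_sum_range_le (c := (T + 1) / ∫ y, min y 1 ∂(law P Y))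
    (integral_taken_nonneg T)
    fun N => (le_div_iff₀ hμ).2 (sum_integral_taken_le hY hident hS hT N)).tendsto_atTop_zero

/-- Lower bound for the expected cost up to the horizon. -/
lemma Certificate.le_integral_runningCost (hY : ∀ i, Measurable (Y i))
    (hident : ∀ i, IdentDistrib (Y i) (Y 0) P P)
    (hint : Integrable (fun ω => (Y 0 ω : ℝ)) P) (hpos : 0 < ∫ ω, (Y 0 ω : ℝ) ∂P)
    (hS : IsCausal P Y S) (hc : Certificate P Y S r Q lam b) {C K m T : ℝ} (hC : 0 ≤ C)
    (hK : 0 ≤ K) (hm : 0 ≤ m) (hT : 0 ≤ T)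
    (hV : ∀ a, 0 ≤ a → relValue r Q b ((lam - b) * ∫ y, y ∂(law P Y)) a ≤ C)
    (hover : ∀ x y, 0 ≤ x → 0 ≤ y → serviceCost r lam b x y ≤ K * y) :
    ∫ ω, serviceCost r lam b 0 (Y 0 ω) ∂P - C - (C + K * m)
      - K * (∫ y, max (y - m) 0 ∂(law P Y)) * ((T + 1) / ∫ y, min y 1 ∂(law P Y))
    ≤ ∫ ω, (∫ t in (0 : ℝ)..T, runningCost r lam b Y S t ω) ∂P := by
  have := isProbabilityMeasure_law (P := P) hY
  have hμ := integral_min_one_pos (ae_law_nonneg (P := P) hY) (by rwa [integral_law_id hY])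
  set κ := (lam - b) * ∫ y, y ∂(law P Y) with hκ
  set μ := ∫ y, max (y - m) 0 ∂(law P Y) with hμm
  have hμ0 : 0 ≤ μ := integral_nonneg fun y => le_max_right _ _
  obtain ⟨B, hB0, hB⟩ := exists_bound_runningCost (Ω := Ω) hc.cont lam b T
  have hidlaw := integrable_law_id hY hint
  have hexc : Integrable (fun y => max (y - m) 0) (law P Y) :=
    (hidlaw.sub (integrable_const m)).pos_part
  have hgm : Measurable fun y => relValue r Q b κ y - K * max (y - m) 0 :=
    hc.measurable_relValue.sub (by fun_prop)
  have hgi : Integrable (fun y => relValue r Q b κ y - K * max (y - m) 0) (law P Y) :=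
    hc.integrable_value.sub (hexc.const_mul K)
  have hg : - (K * μ) ≤ ∫ y, (relValue r Q b κ y - K * max (y - m) 0) ∂(law P Y) := by
    rw [integral_sub hc.integrable_value (hexc.const_mul K), integral_const_mul]
    linarith [hc.value_nonneg]
  have i1 := fun n => hc.integrable_service hY hident hint hS hT n
  have i2 := fun n => integrable_taken_mul hS.measurable T n
    (integrable_comp_transmission hY hident hgi n)
  have i3 : ∀ n, Integrable (fun ω => taken S T n ω * relValue r Q b κ (samplingAge S n ω)) P :=
    fun n => hc.integrable_taken_relValue hS hT n
  have i12 : ∀ n, Integrable (fun ω =>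
      taken S T n ω * serviceCost r lam b (samplingAge S n ω) (Y n ω)
        + taken S T n ω * (relValue r Q b κ (Y n ω) - K * max ((Y n ω : ℝ) - m) 0)) P :=
    fun n => (i1 n).add (i2 n)
  have i123 : ∀ n, Integrable (fun ω =>
      taken S T n ω * serviceCost r lam b (samplingAge S n ω) (Y n ω)
        + taken S T n ω * (relValue r Q b κ (Y n ω) - K * max ((Y n ω : ℝ) - m) 0)
        - taken S T (n + 1) ω * relValue r Q b κ (samplingAge S (n + 1) ω)) P :=
    fun n => (i12 n).sub (i3 (n + 1))
  have i4 := fun n => integrable_taken (P := P) hS.measurable T n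
  have key : ∀ N : ℕ, ∫ ω, serviceCost r lam b 0 (Y 0 ω) ∂P - C - (C + K * m)
      - K * μ * ((T + 1) / ∫ y, min y 1 ∂(law P Y)) - B * T * ∫ ω, taken S T (N + 1) ω ∂P
      ≤ ∫ ω, (∫ t in (0 : ℝ)..T, runningCost r lam b Y S t ω) ∂P := by
    intro N
    have hpath := fun ω => sum_segment_le hc.cont hY hS hK hm hT hV hover hc.wait hB0
      (fun t ω => hB Y S t ω) (N + 1) ω
    have j1 := integrable_finsetSum (Finset.range (N + 1)) fun n _ => i123 n
    have j2 : Integrable (fun ω => (C + K * m) * (1 - taken S T (N + 1) ω)) P :=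
      ((integrable_const 1).sub (i4 (N + 1))).const_mul (C + K * m)
    have j3 : Integrable (fun ω => B * T * taken S T (N + 1) ω) P :=
      (i4 (N + 1)).const_mul (B * T)
    have hmono := integral_mono ((j1.sub j2).sub j3)
      (integrable_integral_runningCost hc.cont lam b hY hS.measurable hT) hpath
    refine le_trans ?_ hmono
    rw [integral_sub' (j1.sub j2) j3, integral_sub' j1 j2, integral_finsetSum _ fun n _ => i123 n]
    have hterm : ∀ n, ∫ ω, (taken S T n ω * serviceCost r lam b (samplingAge S n ω) (Y n ω)
        + taken S T n ω * (relValue r Q b κ (Y n ω) - K * max ((Y n ω : ℝ) - m) 0)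
        - taken S T (n + 1) ω * relValue r Q b κ (samplingAge S (n + 1) ω)) ∂P =
        ∫ ω, taken S T n ω * serviceCost r lam b (samplingAge S n ω) (Y n ω) ∂P
        + (∫ ω, taken S T n ω ∂P) *
          ∫ y, (relValue r Q b κ y - K * max (y - m) 0) ∂(law P Y)
        - ∫ ω, taken S T (n + 1) ω * relValue r Q b κ (samplingAge S (n + 1) ω) ∂P := by
      intro n
      rw [integral_sub (i12 n) (i3 (n + 1)), integral_add (i1 n) (i2 n),
        ← integral_taken_mul hY hident hS T n hgm]
    simp only [hterm]
    -- The service sum loses its first term and the `relValue` sum its last, so both run over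
    -- samples `n + 1` with `n < N` and can be compared term by term. The leftovers are the first
    -- service cost and a `relValue` at most `C`.
    rw [Finset.sum_sub_distrib, Finset.sum_add_distrib, ← Finset.sum_mul,
      Finset.sum_range_succ', Finset.sum_range_succ (fun n => ∫ ω, taken S T (n + 1) ω *
        relValue r Q b κ (samplingAge S (n + 1) ω) ∂P)]
    have hfirst : ∫ ω, taken S T 0 ω * serviceCost r lam b (samplingAge S 0 ω) (Y 0 ω) ∂P =
        ∫ ω, serviceCost r lam b 0 (Y 0 ω) ∂P := by
      simp [taken, samplingAge, hS.zero]
    rw [hfirst]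
    have hmid : ∑ n ∈ Finset.range N, ∫ ω, taken S T (n + 1) ω *
        relValue r Q b κ (samplingAge S (n + 1) ω) ∂P ≤
        ∑ n ∈ Finset.range N, ∫ ω, taken S T (n + 1) ω *
        serviceCost r lam b (samplingAge S (n + 1) ω) (Y (n + 1) ω) ∂P :=
      Finset.sum_le_sum fun n _ => hc.integral_taken_relValue_le hY hident hint hS hT n
    have hlast : ∫ ω, taken S T (N + 1) ω *
        relValue r Q b κ (samplingAge S (N + 1) ω) ∂P ≤ C := by
      calc _ ≤ ∫ _, C ∂P := by
            refine integral_mono (i3 (N + 1)) (integrable_const C) fun ω => ?_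
            simp only [taken]
            split_ifs with h
            · rw [one_mul]
              exact hV _ (samplingAge_mem hS.delivery_le hT h).1
            · simpa using hC
        _ = C := by simp
    have hsum : - (K * μ * ((T + 1) / ∫ y, min y 1 ∂(law P Y))) ≤
        (∑ n ∈ Finset.range (N + 1), ∫ ω, taken S T n ω ∂P) *
          ∫ y, (relValue r Q b κ y - K * max (y - m) 0) ∂(law P Y) := by
      have hs0 : 0 ≤ ∑ n ∈ Finset.range (N + 1), ∫ ω, taken S T n ω ∂P :=
        Finset.sum_nonneg fun n _ => integral_taken_nonneg T n
      have hs1 := (le_div_iff₀ hμ).2 (sum_integral_taken_le hY hident hS hT (N + 1))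
      have h7 := mul_le_mul_of_nonneg_left hg hs0
      have h8 := mul_le_mul_of_nonneg_left hs1 (mul_nonneg hK hμ0)
      linarith
    have hD : ∫ ω, (C + K * m) * (1 - taken S T (N + 1) ω) ∂P ≤ C + K * m := by
      rw [integral_const_mul, integral_sub (integrable_const _) (i4 _)]
      simp only [integral_const, probReal_univ, one_smul]
      have := integral_taken_nonneg (P := P) (S := S) T (N + 1)
      have h9 : 0 ≤ C + K * m := by positivity
      nlinarith
    rw [integral_const_mul (B * T)]
    linarith
  -- With `T` fixed, `N → ∞` removes the contribution of samples beyond the first `N + 1`.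
  have hlim : Tendsto (fun N : ℕ => ∫ ω, serviceCost r lam b 0 (Y 0 ω) ∂P - C - (C + K * m)
      - K * μ * ((T + 1) / ∫ y, min y 1 ∂(law P Y)) - B * T * ∫ ω, taken S T (N + 1) ω ∂P) atTop
      (nhds (∫ ω, serviceCost r lam b 0 (Y 0 ω) ∂P - C - (C + K * m)
      - K * μ * ((T + 1) / ∫ y, min y 1 ∂(law P Y)) - B * T * 0)) :=
    (((tendsto_integral_taken hY hident hpos hS hT).comp
      (tendsto_add_atTop_nat 1)).const_mul (B * T)).const_sub _
  rw [mul_zero, sub_zero] at hlim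
  exact le_of_tendsto' hlim key

/-- Expected average cost up to the horizon `T`. -/
def meanCost (P : Measure Ω) (r : ℝ → ℝ) (lam : ℝ) (Y : ℕ → Ω → ℝ≥0) (S : ℕ → Ω → ℝ≥0∞)
    (T : ℝ) : ℝ :=
  ∫ ω, (1 / T * ∫ t in (0 : ℝ)..T, (r (age Y S t ω) + lam * occupation Y S t ω)) ∂P

lemma meanCost_eq (hr : Continuous r) (hY : ∀ i, Measurable (Y i))
    (hS : ∀ i, Measurable (S i)) {T : ℝ} (hT : 0 < T) :
    meanCost P r lam Y S T =
      b + (∫ ω, (∫ t in (0 : ℝ)..T, runningCost r lam b Y S t ω) ∂P) / T := by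
  have h : ∀ ω, ∫ t in (0 : ℝ)..T, (r (age Y S t ω) + lam * occupation Y S t ω) =
      (∫ t in (0 : ℝ)..T, runningCost r lam b Y S t ω) + b * T := by
    intro ω
    have : ∀ t, r (age Y S t ω) + lam * occupation Y S t ω = runningCost r lam b Y S t ω + b :=
      fun t => by rw [runningCost]; ring
    simp only [this]
    rw [intervalIntegral.integral_add
      (intervalIntegrable_runningCost hr lam b hY hS ω le_rfl hT.le) (by simp)]
    simp [mul_comm]
  unfold meanCost
  rw [integral_const_mul]
  simp only [h]
  rw [integral_add (integrable_integral_runningCost hr lam b hY hS hT.le) (integrable_const _)]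
  simp only [integral_const, probReal_univ, one_smul]
  field_simp
  ring

/-- Verification theorem: a certificate bounds the average cost from below. -/
theorem Certificate.eventually_le (hY : ∀ i, Measurable (Y i))
    (hident : ∀ i, IdentDistrib (Y i) (Y 0) P P)
    (hint : Integrable (fun ω => (Y 0 ω : ℝ)) P) (hpos : 0 < ∫ ω, (Y 0 ω : ℝ) ∂P)
    (hS : IsCausal P Y S) (hc : Certificate P Y S r Q lam b) {ε : ℝ} (hε : 0 < ε) :
    ∀ᶠ T in atTop, b - ε ≤ meanCost P r lam Y S T := by
  have := isProbabilityMeasure_law (P := P) hY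
  have hμ := integral_min_one_pos (ae_law_nonneg (P := P) hY) (by rwa [integral_law_id hY])
  obtain ⟨C, hV⟩ := hc.upper
  obtain ⟨K, hK, hover⟩ := hc.overshoot
  set μ1 := ∫ y, min y 1 ∂(law P Y)
  have hexc := (tendsto_integral_excess (integrable_law_id hY hint)).const_mul (K / μ1)
  rw [mul_zero] at hexc
  -- `m` is fixed before `T`: the expected excess over `m`, times the sampling frequency, which is
  -- at most about `1 / μ1`, then costs less than `ε / 2` per unit of time.
  obtain ⟨m, hm⟩ := (hexc.eventually_lt_const (half_pos hε)).exists
  set μ := ∫ y, max (y - m) 0 ∂(law P Y)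
  -- All terms that do not grow with `T`; the last one comes from the `1` in `T + 1`.
  set A := ∫ ω, serviceCost r lam b 0 (Y 0 ω) ∂P - |C| - (|C| + K * m) - K / μ1 * μ with hA
  have hlim : Tendsto (fun T : ℝ => A / T) atTop (nhds 0) := tendsto_const_nhds.div_atTop tendsto_id
  filter_upwards [hlim.eventually_const_lt (show -(ε / 2) < 0 by linarith), eventually_gt_atTop 0]
    with T h1 hT
  rw [meanCost_eq (b := b) hc.cont hY hS.measurable hT]
  have h2 := hc.le_integral_runningCost hY hident hint hpos hS (abs_nonneg C) hK
    (Nat.cast_nonneg m) hT.le (fun a ha => (hV a ha).trans (le_abs_self C)) hover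
  have h3 : A - K / μ1 * μ * T ≤ ∫ ω, (∫ t in (0 : ℝ)..T, runningCost r lam b Y S t ω) ∂P := by
    refine le_trans (le_of_eq ?_) h2
    rw [hA]
    ring
  have h4 : A / T - K / μ1 * μ ≤
      (∫ ω, (∫ t in (0 : ℝ)..T, runningCost r lam b Y S t ω) ∂P) / T := by
    rw [le_div_iff₀ hT]
    refine le_trans (le_of_eq ?_) h3
    field_simp
  linarith

end Verification

/-! ### Optimisation of a single cycle -/

/-- Penalty rates for which all expectations over two transmissions are finite. -/
structure IsRate (r : ℝ → ℝ) (ν : Measure ℝ) : Prop where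
  cont : Continuous r
  mono : Monotone r
  zero : r 0 = 0
  integrable : ∀ c, 0 ≤ c → Integrable (fun z : ℝ × ℝ => prim r (c + z.1 + z.2)) (ν.prod ν)

/-- Expected penalty rate at the delivery of a sample that is taken at age `x`. -/
def deliveryRate (r : ℝ → ℝ) (ν : Measure ℝ) (x : ℝ) : ℝ := ∫ y, r (x + y) ∂ν

/-- Expected cost of a cycle in which the sample is taken at age `u`, with reward `b` per unit of
time. -/
def sampleCost (r : ℝ → ℝ) (ν : Measure ℝ) (b u : ℝ) : ℝ := ∫ y, prim r (u + y) ∂ν - b * u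

/-- Expected net cost of a cycle when samples are taken at age at least `τ`. -/
def gain (r : ℝ → ℝ) (ν : Measure ℝ) (lam b τ : ℝ) : ℝ :=
  ∫ z : ℝ × ℝ, prim r (max z.1 τ + z.2) ∂(ν.prod ν) - ∫ y, prim r y ∂ν + lam * ∫ y, y ∂ν
    - b * ∫ y, max y τ ∂ν

/-- `τ` separates the ages at which the expected rate at delivery is below `b` from the others. -/
structure IsThreshold (r : ℝ → ℝ) (ν : Measure ℝ) (b τ : ℝ) : Prop where
  nonneg : 0 ≤ τ
  lt : ∀ x, 0 ≤ x → x < τ → deliveryRate r ν x < b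
  le : ∀ x, τ < x → b ≤ deliveryRate r ν x

section Prim

variable {r : ℝ → ℝ}

lemma prim_sub_le (hc : Continuous r) (hm : Monotone r) {u v : ℝ} (h : u ≤ v) :
    prim r v - prim r u ≤ (v - u) * r v := by
  rw [← integral_eq_prim_sub hc]
  have := intervalIntegral.integral_mono_on (μ := volume) (f := r) (g := fun _ => r v) h
    (hc.intervalIntegrable _ _) (by simp) fun x hx => hm hx.2
  simpa using this

lemma le_prim_sub (hc : Continuous r) (hm : Monotone r) {u v : ℝ} (h : u ≤ v) :
    (v - u) * r u ≤ prim r v - prim r u := by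
  rw [← integral_eq_prim_sub hc]
  have := intervalIntegral.integral_mono_on (μ := volume) (g := r) (f := fun _ => r u) h
    (by simp) (hc.intervalIntegrable _ _) fun x hx => hm hx.1
  simpa using this

lemma prim_zero : prim r 0 = 0 := intervalIntegral.integral_same

lemma prim_nonneg (hc : Continuous r) (hm : Monotone r) (h0 : r 0 = 0) (x : ℝ) :
    0 ≤ prim r x := by
  rcases le_total 0 x with hx | hx
  · simpa [h0, prim_zero] using le_prim_sub hc hm hx
  · simpa [h0, prim_zero] using prim_sub_le hc hm hx

lemma prim_mono (hc : Continuous r) (hm : Monotone r) (h0 : r 0 = 0) {u v : ℝ} (hu : 0 ≤ u)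
    (h : u ≤ v) : prim r u ≤ prim r v := by
  have h1 := le_prim_sub hc hm h
  have h2 : 0 ≤ r u := h0 ▸ hm hu
  nlinarith [mul_nonneg (sub_nonneg.2 h) h2]

lemma prim_sub_prim_mono {r' : ℝ → ℝ} (hc : Continuous r) (hc' : Continuous r')
    (hle : ∀ x, 0 ≤ x → r' x ≤ r x) {u v : ℝ} (hu : 0 ≤ u) (h : u ≤ v) :
    prim r u - prim r' u ≤ prim r v - prim r' v := by
  have := intervalIntegral.integral_mono_on (μ := volume) (f := r') (g := r) h
    (hc'.intervalIntegrable _ _) (hc.intervalIntegrable _ _) fun x hx => hle x (hu.trans hx.1)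
  rw [integral_eq_prim_sub hc, integral_eq_prim_sub hc'] at this
  linarith

end Prim

section Rate

variable {r : ℝ → ℝ} {ν : Measure ℝ} [IsProbabilityMeasure ν]

lemma IsRate.nonneg (h : IsRate r ν) {x : ℝ} (hx : 0 ≤ x) : 0 ≤ r x := h.zero ▸ h.mono hx

lemma ae_prod_nonneg (h0 : ∀ᵐ y ∂ν, 0 ≤ y) : ∀ᵐ z ∂(ν.prod ν), 0 ≤ z.1 ∧ 0 ≤ z.2 :=
  (Measure.quasiMeasurePreserving_fst.ae h0).and (Measure.quasiMeasurePreserving_snd.ae h0)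

lemma IsRate.integrable_prim_max (h : IsRate r ν) (h0 : ∀ᵐ y ∂ν, 0 ≤ y) {τ : ℝ} (hτ : 0 ≤ τ) :
    Integrable (fun z : ℝ × ℝ => prim r (max z.1 τ + z.2)) (ν.prod ν) := by
  have hp := continuous_prim h.cont
  refine (h.integrable τ hτ).mono' (Continuous.aestronglyMeasurable (by fun_prop)) ?_
  filter_upwards [ae_prod_nonneg h0] with z hz
  rw [Real.norm_eq_abs, abs_of_nonneg (prim_nonneg h.cont h.mono h.zero _)]
  refine prim_mono h.cont h.mono h.zero ?_ ?_
  · linarith [le_max_right z.1 τ, hz.2]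
  · have : max z.1 τ ≤ τ + z.1 := max_le (by linarith) (by linarith [hz.1])
    linarith

lemma IsRate.integrable_prim (h : IsRate r ν) (h0 : ∀ᵐ y ∂ν, 0 ≤ y) {u : ℝ} (hu : 0 ≤ u) :
    Integrable (fun y => prim r (u + y)) ν := by
  have hp := continuous_prim h.cont
  have hi : Integrable ((fun y => prim r (u + y)) ∘ Prod.fst) (ν.prod ν) := by
    refine (h.integrable u hu).mono' ?_ ?_
    · exact (Continuous.comp (by fun_prop) continuous_fst).aestronglyMeasurable
    · filter_upwards [ae_prod_nonneg h0] with z hz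
      rw [Function.comp_apply, Real.norm_eq_abs, abs_of_nonneg (prim_nonneg h.cont h.mono h.zero _)]
      exact prim_mono h.cont h.mono h.zero (by linarith [hz.1]) (by linarith [hz.2])
  exact (measurePreserving_fst.integrable_comp
    (Continuous.aestronglyMeasurable (by fun_prop))).1 hi

/-- As `r` is monotone, `r (u + y)` is at most its integral over the next unit interval, hence at
most `prim r (u + 1 + y)`. -/
lemma IsRate.integrable_rate (h : IsRate r ν) (h0 : ∀ᵐ y ∂ν, 0 ≤ y) {u : ℝ} (hu : 0 ≤ u) :
    Integrable (fun y => r (u + y)) ν := by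
  have hc := h.cont
  refine (h.integrable_prim h0 (show 0 ≤ u + 1 by linarith)).mono'
    (Continuous.aestronglyMeasurable (by fun_prop)) ?_
  filter_upwards [h0] with y hy
  rw [Real.norm_eq_abs, abs_of_nonneg (h.nonneg (by linarith))]
  have h1 := le_prim_sub h.cont h.mono (show u + y ≤ u + 1 + y by linarith)
  have h2 := prim_nonneg h.cont h.mono h.zero (u + y)
  linarith

lemma IsRate.deliveryRate_mono (h : IsRate r ν) (h0 : ∀ᵐ y ∂ν, 0 ≤ y) {u v : ℝ} (hu : 0 ≤ u)
    (huv : u ≤ v) : deliveryRate r ν u ≤ deliveryRate r ν v :=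
  integral_mono (h.integrable_rate h0 hu) (h.integrable_rate h0 (hu.trans huv))
    fun y => h.mono (by simpa using huv)

/-- Convexity of `sampleCost`, whose formal derivative is `deliveryRate - b`. This bound and the
next one take the place of differentiation under the integral. -/
lemma IsRate.sampleCost_sub_le (h : IsRate r ν) (h0 : ∀ᵐ y ∂ν, 0 ≤ y) (b : ℝ) {u v : ℝ}
    (hu : 0 ≤ u) (huv : u ≤ v) :
    sampleCost r ν b v - sampleCost r ν b u ≤ (v - u) * (deliveryRate r ν v - b) := by
  have h1 := integral_mono ((h.integrable_prim h0 (hu.trans huv)).sub (h.integrable_prim h0 hu))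
    ((h.integrable_rate h0 (hu.trans huv)).const_mul (v - u)) fun y => by
      have := prim_sub_le h.cont h.mono (show u + y ≤ v + y by linarith)
      rwa [add_sub_add_right_eq_sub] at this
  rw [integral_sub' (h.integrable_prim h0 (hu.trans huv)) (h.integrable_prim h0 hu),
    integral_const_mul] at h1
  unfold sampleCost
  rw [deliveryRate]
  linarith

lemma IsRate.le_sampleCost_sub (h : IsRate r ν) (h0 : ∀ᵐ y ∂ν, 0 ≤ y) (b : ℝ) {u v : ℝ}
    (hu : 0 ≤ u) (huv : u ≤ v) :
    (v - u) * (deliveryRate r ν u - b) ≤ sampleCost r ν b v - sampleCost r ν b u := by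
  have h1 := integral_mono ((h.integrable_rate h0 hu).const_mul (v - u))
    ((h.integrable_prim h0 (hu.trans huv)).sub (h.integrable_prim h0 hu)) fun y => by
      have := le_prim_sub h.cont h.mono (show u + y ≤ v + y by linarith)
      rwa [add_sub_add_right_eq_sub] at this
  rw [integral_sub' (h.integrable_prim h0 (hu.trans huv)) (h.integrable_prim h0 hu),
    integral_const_mul] at h1
  unfold sampleCost
  rw [deliveryRate]
  linarith

lemma IsRate.sampleCost_mono (h : IsRate r ν) (h0 : ∀ᵐ y ∂ν, 0 ≤ y) {b τ : ℝ}
    (ht : IsThreshold r ν b τ) {u v : ℝ} (hu : τ ≤ u) (huv : u ≤ v) :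
    sampleCost r ν b u ≤ sampleCost r ν b v := by
  rcases eq_or_lt_of_le huv with rfl | huv
  · exact le_rfl
  have hu0 := ht.nonneg.trans hu
  -- `IsThreshold` says nothing about the rate at `τ` itself, and `u = τ` is allowed. The comparison
  -- is made from an intermediate `x > u`, and the error on `[u, x]` vanishes as `x` decreases to
  -- `u`.
  have hlim : Tendsto (fun x => (x - u) * (deliveryRate r ν u - b)) (nhdsWithin u (Set.Ioi u))
      (nhds ((u - u) * (deliveryRate r ν u - b))) :=
    (Continuous.tendsto (by fun_prop) u).mono_left nhdsWithin_le_nhds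
  rw [sub_self, zero_mul] at hlim
  refine sub_nonneg.1 (le_of_tendsto hlim ?_)
  filter_upwards [Ioo_mem_nhdsGT huv] with x hx
  have h1 := h.le_sampleCost_sub h0 b hu0 hx.1.le
  have h2 := h.le_sampleCost_sub h0 b (hu0.trans hx.1.le) hx.2.le
  have h3 := mul_nonneg (sub_nonneg.2 hx.2.le) (sub_nonneg.2 (ht.le x (hu.trans_lt hx.1)))
  linarith

lemma IsRate.sampleCost_anti (h : IsRate r ν) (h0 : ∀ᵐ y ∂ν, 0 ≤ y) {b τ : ℝ}
    (ht : IsThreshold r ν b τ) {u v : ℝ} (hu : 0 ≤ u) (huv : u ≤ v) (hv : v ≤ τ) :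
    sampleCost r ν b v ≤ sampleCost r ν b u := by
  rcases eq_or_lt_of_le huv with rfl | huv
  · exact le_rfl
  have hlim : Tendsto (fun x => (v - x) * (deliveryRate r ν v - b)) (nhdsWithin v (Set.Iio v))
      (nhds ((v - v) * (deliveryRate r ν v - b))) :=
    (Continuous.tendsto (by fun_prop) v).mono_left nhdsWithin_le_nhds
  rw [sub_self, zero_mul] at hlim
  refine sub_nonpos.1 (ge_of_tendsto hlim ?_)
  filter_upwards [Ioo_mem_nhdsLT huv] with x hx
  have h1 := h.sampleCost_sub_le h0 b hu hx.1.le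
  have h2 := h.sampleCost_sub_le h0 b (hu.trans hx.1.le) hx.2.le
  have h3 := mul_nonneg (sub_nonneg.2 hx.1.le)
    (sub_nonneg.2 (ht.lt x (hu.trans hx.1.le) (hx.2.trans_le hv)).le)
  linarith

/-- Sampling at the threshold is optimal. -/
lemma IsRate.sampleCost_max_le (h : IsRate r ν) (h0 : ∀ᵐ y ∂ν, 0 ≤ y) {b τ : ℝ}
    (ht : IsThreshold r ν b τ) {a u : ℝ} (ha : 0 ≤ a) (hau : a ≤ u) :
    sampleCost r ν b (max a τ) ≤ sampleCost r ν b u := by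
  rcases le_total τ u with hu | hu
  · exact h.sampleCost_mono h0 ht (le_max_right _ _) (max_le hau hu)
  · rw [max_eq_right (hau.trans hu)]
    exact h.sampleCost_anti h0 ht (ha.trans hau) hu le_rfl

lemma integrable_max (hint : Integrable (fun y => y) ν) (τ : ℝ) :
    Integrable (fun y => max y τ) ν :=
  hint.sup (integrable_const τ)

lemma IsRate.integrable_sampleCost_max (h : IsRate r ν) (h0 : ∀ᵐ y ∂ν, 0 ≤ y)
    (hint : Integrable (fun y => y) ν) (b : ℝ) {τ : ℝ} (hτ : 0 ≤ τ) :
    Integrable (fun y => sampleCost r ν b (max y τ)) ν :=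
  (h.integrable_prim_max h0 hτ).integral_prod_left.sub ((integrable_max hint τ).const_mul b)

/-- Integrating out the second transmission first puts the dependence on `τ` into `sampleCost` at
the sampling age `max y τ`, so thresholds can be compared pointwise in `y`. -/
lemma IsRate.gain_eq (h : IsRate r ν) (h0 : ∀ᵐ y ∂ν, 0 ≤ y)
    (hint : Integrable (fun y => y) ν) (lam b : ℝ) {τ : ℝ} (hτ : 0 ≤ τ) :
    gain r ν lam b τ = ∫ y, sampleCost r ν b (max y τ) ∂ν - ∫ y, prim r y ∂ν
      + lam * ∫ y, y ∂ν := by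
  have h1 := h.integrable_prim_max h0 hτ
  unfold gain sampleCost
  rw [integral_sub h1.integral_prod_left ((integrable_max hint τ).const_mul b),
    integral_prod _ h1, integral_const_mul]
  ring

lemma IsRate.gain_le (h : IsRate r ν) (h0 : ∀ᵐ y ∂ν, 0 ≤ y)
    (hint : Integrable (fun y => y) ν) (lam : ℝ) {b τ τ' : ℝ} (ht : IsThreshold r ν b τ)
    (hτ' : 0 ≤ τ') : gain r ν lam b τ ≤ gain r ν lam b τ' := by
  rw [h.gain_eq h0 hint lam b ht.nonneg, h.gain_eq h0 hint lam b hτ']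
  have := integral_mono_ae (h.integrable_sampleCost_max h0 hint b ht.nonneg)
    (h.integrable_sampleCost_max h0 hint b hτ') (by
      filter_upwards [h0] with y hy
      exact h.sampleCost_max_le h0 ht hy (le_max_left y τ'))
  linarith

lemma gain_sub_gain (lam b b' τ : ℝ) :
    gain r ν lam b τ - gain r ν lam b' τ = (b' - b) * ∫ y, max y τ ∂ν := by
  unfold gain
  ring

lemma integral_le_integral_max (hint : Integrable (fun y => y) ν) (τ : ℝ) :
    ∫ y, y ∂ν ≤ ∫ y, max y τ ∂ν :=
  integral_mono hint (integrable_max hint τ) fun y => le_max_left y τ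

lemma integral_max_mono (hint : Integrable (fun y => y) ν) {τ τ' : ℝ} (h : τ ≤ τ') :
    ∫ y, max y τ ∂ν ≤ ∫ y, max y τ' ∂ν :=
  integral_mono (integrable_max hint τ) (integrable_max hint τ') fun _ => max_le_max_left _ h

/-- The penalty part is nonnegative because `prim r` increases. Since `-b ≥ 0` and `max y τ ≥ y`,
the rest is at least `(lam - b) ∫ y`. -/
lemma IsRate.gain_nonneg_of_le (h : IsRate r ν) (h0 : ∀ᵐ y ∂ν, 0 ≤ y)
    (hint : Integrable (fun y => y) ν) {lam b τ : ℝ} (hb : b ≤ -|lam|) (hτ : 0 ≤ τ) :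
    0 ≤ gain r ν lam b τ := by
  have h1 : ∫ y, prim r y ∂ν ≤ ∫ z : ℝ × ℝ, prim r (max z.1 τ + z.2) ∂(ν.prod ν) := by
    have h2 : Integrable (prim r) ν := by simpa using h.integrable_prim h0 le_rfl
    have h3 : ∫ y, prim r y ∂ν = ∫ z : ℝ × ℝ, prim r z.1 ∂(ν.prod ν) := by
      rw [integral_fun_fst]
      simp
    rw [h3]
    refine integral_mono_ae (h2.comp_fst ν) (h.integrable_prim_max h0 hτ) ?_
    filter_upwards [ae_prod_nonneg h0] with z hz
    exact prim_mono h.cont h.mono h.zero hz.1 (by linarith [le_max_left z.1 τ, hz.2])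
  have hy : 0 ≤ ∫ y, y ∂ν := integral_nonneg_of_ae h0
  have h4 := integral_le_integral_max hint τ
  have h5 := neg_abs_le lam
  have h6 : -b * ∫ y, y ∂ν ≤ -b * ∫ y, max y τ ∂ν :=
    mul_le_mul_of_nonneg_left h4 (by linarith [abs_nonneg lam])
  have h7 : 0 ≤ (lam - b) * ∫ y, y ∂ν := mul_nonneg (by linarith) hy
  unfold gain
  linarith

/-- Monotonicity of `deliveryRate` makes the set upward closed, so its infimum separates. Whether
the infimum is attained does not matter for `IsThreshold`. -/
lemma IsRate.isThreshold_sInf (h : IsRate r ν) (h0 : ∀ᵐ y ∂ν, 0 ≤ y) {b : ℝ}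
    (hb : ∃ x, 0 ≤ x ∧ b ≤ deliveryRate r ν x) :
    IsThreshold r ν b (sInf {x | 0 ≤ x ∧ b ≤ deliveryRate r ν x}) := by
  have hbdd : BddBelow {x | 0 ≤ x ∧ b ≤ deliveryRate r ν x} := ⟨0, fun x hx => hx.1⟩
  refine ⟨Real.sInf_nonneg fun x hx => hx.1, fun x hx hlt => ?_, fun x hx => ?_⟩
  · by_contra hc
    exact absurd (csInf_le hbdd ⟨hx, not_lt.1 hc⟩) (not_le.2 hlt)
  · obtain ⟨x', hx', hlt⟩ := exists_lt_of_csInf_lt hb hx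
    exact hx'.2.trans (h.deliveryRate_mono h0 hx'.1 hlt.le)

/-- The net cost of a cycle under the optimal threshold vanishes for some reward, as soon as it
is negative for some reward. -/
lemma IsRate.exists_gain_eq_zero (h : IsRate r ν) (h0 : ∀ᵐ y ∂ν, 0 ≤ y)
    (hint : Integrable (fun y => y) ν) (lam : ℝ) {b₁ τ₁ : ℝ}
    (hb₁ : ∃ x, 0 ≤ x ∧ b₁ ≤ deliveryRate r ν x) (hτ₁ : 0 ≤ τ₁) (hg : gain r ν lam b₁ τ₁ < 0) :
    ∃ b τ, IsThreshold r ν b τ ∧ gain r ν lam b τ = 0 := by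
  set thr : ℝ → ℝ := fun b => sInf {x | 0 ≤ x ∧ b ≤ deliveryRate r ν x} with hthr
  have hex : ∀ b ≤ b₁, ∃ x, 0 ≤ x ∧ b ≤ deliveryRate r ν x := fun b hb =>
    hb₁.imp fun x hx => ⟨hx.1, hb.trans hx.2⟩
  have ht : ∀ b ≤ b₁, IsThreshold r ν b (thr b) := fun b hb => h.isThreshold_sInf h0 (hex b hb)
  have hmono : ∀ b ≤ b₁, thr b ≤ thr b₁ := fun b hb =>
    csInf_le_csInf ⟨0, fun x hx => hx.1⟩ hb₁ fun x hx => ⟨hx.1, hb.trans hx.2⟩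
  set L := ∫ y, max y (thr b₁) ∂ν with hL
  have hy : 0 ≤ ∫ y, y ∂ν := integral_nonneg_of_ae h0
  -- Envelope argument: each optimal threshold is tested against the other reward, where `gain` is
  -- affine. The slopes are bounded by `L`, the mean cycle length for the largest threshold.
  have hlip : ∀ b b', b ≤ b' → b' ≤ b₁ →
      gain r ν lam b' (thr b') ≤ gain r ν lam b (thr b) ∧
      gain r ν lam b (thr b) ≤ gain r ν lam b' (thr b') + (b' - b) * L := by
    intro b b' hbb hb'
    have h1 := h.gain_le h0 hint lam (ht b' hb') (ht b (hbb.trans hb')).nonneg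
    have h2 := h.gain_le h0 hint lam (ht b (hbb.trans hb')) (ht b' hb').nonneg
    have h3 := gain_sub_gain (r := r) (ν := ν) lam b b' (thr b)
    have h4 := gain_sub_gain (r := r) (ν := ν) lam b b' (thr b')
    have h5 : 0 ≤ (b' - b) * ∫ y, max y (thr b) ∂ν :=
      mul_nonneg (by linarith) (hy.trans (integral_le_integral_max hint _))
    have h6 : (b' - b) * ∫ y, max y (thr b') ∂ν ≤ (b' - b) * L :=
      mul_le_mul_of_nonneg_left (integral_max_mono hint (hmono b' hb')) (by linarith)
    constructor <;> linarith
  have hL0 : 0 ≤ L := hy.trans (integral_le_integral_max hint _)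
  have hcont : ContinuousOn (fun b => gain r ν lam b (thr b)) (Set.Iic b₁) := by
    refine LipschitzOnWith.continuousOn (K := L.toNNReal) ?_
    refine LipschitzOnWith.of_dist_le_mul fun b hb b' hb' => ?_
    rw [Real.coe_toNNReal L hL0, Real.dist_eq, Real.dist_eq]
    rcases le_total b b' with hle | hle
    · have := hlip b b' hle hb'
      rw [abs_of_nonneg (by linarith), abs_of_nonpos (by linarith)]
      linarith
    · have := hlip b' b hle hb
      rw [abs_of_nonpos (by linarith), abs_of_nonneg (by linarith)]
      linarith
  have hneg : gain r ν lam b₁ (thr b₁) < 0 :=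
    (h.gain_le h0 hint lam (ht b₁ le_rfl) hτ₁).trans_lt hg
  have hle : -|lam| ≤ b₁ := by
    by_contra hc
    exact absurd (h.gain_nonneg_of_le h0 hint (not_le.1 hc).le (ht b₁ le_rfl).nonneg)
      (not_le.2 hneg)
  have hpos := h.gain_nonneg_of_le h0 hint (lam := lam) le_rfl (ht _ hle).nonneg
  obtain ⟨b, hb, hb0⟩ := intermediate_value_Icc' hle (hcont.mono Set.Icc_subset_Iic_self)
    ⟨hneg.le, hpos⟩
  exact ⟨b, thr b, ht b hb.2, hb0⟩

/-- The reward for which the net cost of a cycle vanishes is unique. -/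
lemma IsRate.gain_eq_zero_unique (h : IsRate r ν) (h0 : ∀ᵐ y ∂ν, 0 ≤ y)
    (hint : Integrable (fun y => y) ν) (hpos : 0 < ∫ y, y ∂ν) {lam b b' τ τ' : ℝ}
    (ht : IsThreshold r ν b τ) (ht' : IsThreshold r ν b' τ') (hg : gain r ν lam b τ = 0)
    (hg' : gain r ν lam b' τ' = 0) : b = b' := by
  by_contra hne
  wlog hlt : b < b' generalizing b b' τ τ'
  · exact this ht' ht hg' hg (Ne.symm hne) (lt_of_le_of_ne (not_lt.1 hlt) (Ne.symm hne))
  have h1 := h.gain_le h0 hint lam ht' ht.nonneg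
  have h2 := gain_sub_gain (r := r) (ν := ν) lam b b' τ
  have h3 := mul_pos (sub_pos.2 hlt) (hpos.trans_le (integral_le_integral_max hint τ))
  linarith

/-! ### Truncation of the rate -/

/-- Truncation of a rate function. -/
def truncRate (r : ℝ → ℝ) (M : ℕ) (x : ℝ) : ℝ := min (r x) M

lemma truncRate_le (r : ℝ → ℝ) (M : ℕ) (x : ℝ) : truncRate r M x ≤ r x := min_le_left _ _

lemma continuous_truncRate (hc : Continuous r) (M : ℕ) : Continuous (truncRate r M) :=
  hc.min continuous_const

lemma prim_truncRate_le (hc : Continuous r) (M : ℕ) {x : ℝ} (hx : 0 ≤ x) :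
    prim (truncRate r M) x ≤ prim r x := by
  have := prim_sub_prim_mono hc (continuous_truncRate hc M) (fun x _ => truncRate_le r M x)
    le_rfl hx
  simp only [prim_zero] at this
  linarith

lemma IsRate.truncRate (h : IsRate r ν) (h0 : ∀ᵐ y ∂ν, 0 ≤ y) (M : ℕ) :
    IsRate (truncRate r M) ν := by
  have hc := continuous_truncRate h.cont M
  have hm : Monotone (AoISampling.truncRate r M) := fun x y hxy => min_le_min_right _ (h.mono hxy)
  have hz : AoISampling.truncRate r M 0 = 0 := by simp [AoISampling.truncRate, h.zero]
  refine ⟨hc, hm, hz, fun c hcc => ?_⟩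
  have hp := continuous_prim hc
  refine (h.integrable c hcc).mono' (Continuous.aestronglyMeasurable (by fun_prop)) ?_
  filter_upwards [ae_prod_nonneg h0] with z hz'
  rw [Real.norm_eq_abs, abs_of_nonneg (prim_nonneg hc hm hz _)]
  exact prim_truncRate_le h.cont M (by linarith [hz'.1, hz'.2])

lemma IsRate.tendsto_deliveryRate_truncRate (h : IsRate r ν) (h0 : ∀ᵐ y ∂ν, 0 ≤ y) {x : ℝ}
    (hx : 0 ≤ x) :
    Tendsto (fun M : ℕ => deliveryRate (AoISampling.truncRate r M) ν x) atTop
      (nhds (deliveryRate r ν x)) := by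
  have hc := h.cont
  refine tendsto_integral_of_dominated_convergence (fun y => r (x + y)) (fun M => ?_)
    (h.integrable_rate h0 hx) (fun M => ?_) (ae_of_all _ fun y => ?_)
  · have := continuous_truncRate h.cont M
    exact Continuous.aestronglyMeasurable (by fun_prop)
  · filter_upwards [h0] with y hy
    rw [Real.norm_eq_abs, abs_of_nonneg ((h.truncRate h0 M).nonneg (by linarith))]
    exact truncRate_le _ _ _
  · refine tendsto_const_nhds.congr' ?_
    filter_upwards [eventually_ge_atTop ⌈r (x + y)⌉₊] with M hM
    exact (min_eq_left (Nat.ceil_le.1 hM)).symm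

lemma prim_truncRate_eq (hm : Monotone r) {x : ℝ} (hx : 0 ≤ x) {M : ℕ} (hM : r x ≤ M) :
    prim (AoISampling.truncRate r M) x = prim r x := by
  refine intervalIntegral.integral_congr fun s hs => ?_
  rw [Set.uIcc_of_le hx] at hs
  exact min_eq_left ((hm hs.2).trans hM)

/-- Dominated convergence: at each point the truncation is inactive once `M` exceeds the largest
value of `r` reached. -/
lemma IsRate.tendsto_integral_prim_truncRate (h : IsRate r ν) (h0 : ∀ᵐ y ∂ν, 0 ≤ y) {c : ℝ}
    (hc : 0 ≤ c) :
    Tendsto (fun M : ℕ => ∫ z : ℝ × ℝ, (prim r (c + z.1 + z.2)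
      - prim (AoISampling.truncRate r M) (c + z.1 + z.2)) ∂(ν.prod ν)) atTop (nhds 0) := by
  have hp := continuous_prim h.cont
  have key := tendsto_integral_of_dominated_convergence (μ := ν.prod ν) (f := fun _ => (0 : ℝ))
    (F := fun (M : ℕ) (z : ℝ × ℝ) => prim r (c + z.1 + z.2)
      - prim (AoISampling.truncRate r M) (c + z.1 + z.2))
    (fun z => prim r (c + z.1 + z.2)) (fun M => ?_) (h.integrable c hc) (fun M => ?_) ?_
  · simpa using key
  · have := continuous_prim (continuous_truncRate h.cont M)
    exact Continuous.aestronglyMeasurable (by fun_prop)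
  · filter_upwards [ae_prod_nonneg h0] with z hz
    have hz' : 0 ≤ c + z.1 + z.2 := by linarith [hz.1, hz.2]
    have ht := h.truncRate h0 M
    rw [Real.norm_eq_abs, abs_of_nonneg (sub_nonneg.2 (prim_truncRate_le h.cont M hz'))]
    linarith [prim_nonneg ht.cont ht.mono ht.zero (c + z.1 + z.2)]
  · filter_upwards [ae_prod_nonneg h0] with z hz
    have hz' : 0 ≤ c + z.1 + z.2 := by linarith [hz.1, hz.2]
    refine tendsto_const_nhds.congr' ?_
    filter_upwards [eventually_ge_atTop ⌈r (c + z.1 + z.2)⌉₊] with M hM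
    rw [prim_truncRate_eq h.mono hz' (Nat.ceil_le.1 hM), sub_self]

/-- Truncating the rate function changes the optimal reward by an arbitrarily small amount. -/
lemma IsRate.exists_truncRate (h : IsRate r ν) (h0 : ∀ᵐ y ∂ν, 0 ≤ y)
    (hint : Integrable (fun y => y) ν) (hpos : 0 < ∫ y, y ∂ν) {lam b τ : ℝ}
    (ht : IsThreshold r ν b τ) (hg : 0 ≤ gain r ν lam b τ) {ε : ℝ} (hε : 0 < ε) :
    ∃ (M : ℕ) (τ' : ℝ), IsThreshold (AoISampling.truncRate r M) ν (b - ε) τ' ∧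
      0 ≤ gain (AoISampling.truncRate r M) ν lam (b - ε) τ' := by
  -- `b ≤ deliveryRate` is known only strictly above `τ`, hence `τ + 1`. With `M` large the
  -- truncated rate exceeds `b - ε` there, which gives `τ' ≤ τ + 1` and a dominating function
  -- independent of `M`.
  have hc : 0 ≤ τ + 1 := by linarith [ht.nonneg]
  have e1 := (h.tendsto_deliveryRate_truncRate h0 hc).eventually_const_lt
    (show b - ε < deliveryRate r ν (τ + 1) by linarith [ht.le (τ + 1) (by linarith)])
  have e2 := (h.tendsto_integral_prim_truncRate h0 hc).eventually_lt_const (mul_pos hε hpos)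
  obtain ⟨M, hM1, hM2⟩ := (e1.and e2).exists
  have hr := h.truncRate h0 M
  have ht' := hr.isThreshold_sInf h0 ⟨τ + 1, hc, hM1.le⟩
  refine ⟨M, _, ht', ?_⟩
  set τ' := sInf {x | 0 ≤ x ∧ b - ε ≤ deliveryRate (AoISampling.truncRate r M) ν x}
  have hτ' : τ' ≤ τ + 1 := csInf_le ⟨0, fun x hx => hx.1⟩ ⟨hc, hM1.le⟩
  have g1 : 0 ≤ gain r ν lam b τ' := hg.trans (h.gain_le h0 hint lam ht ht'.nonneg)
  have g2 : ∫ y, prim (AoISampling.truncRate r M) y ∂ν ≤ ∫ y, prim r y ∂ν := by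
    refine integral_mono_ae (by simpa using hr.integrable_prim h0 le_rfl)
      (by simpa using h.integrable_prim h0 le_rfl) ?_
    filter_upwards [h0] with y hy
    exact prim_truncRate_le h.cont M hy
  have g3 : ∫ z : ℝ × ℝ, prim r (max z.1 τ' + z.2) ∂(ν.prod ν)
      - ∫ z : ℝ × ℝ, prim (AoISampling.truncRate r M) (max z.1 τ' + z.2) ∂(ν.prod ν)
      ≤ ε * ∫ y, y ∂ν := by
    rw [← integral_sub (h.integrable_prim_max h0 ht'.nonneg)
      (hr.integrable_prim_max h0 ht'.nonneg)]
    refine le_trans (integral_mono_ae ((h.integrable_prim_max h0 ht'.nonneg).sub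
      (hr.integrable_prim_max h0 ht'.nonneg)) ((h.integrable _ hc).sub (hr.integrable _ hc)) ?_)
      hM2.le
    filter_upwards [ae_prod_nonneg h0] with z hz
    refine prim_sub_prim_mono h.cont hr.cont (fun x _ => truncRate_le r M x) ?_ ?_
    · linarith [le_max_right z.1 τ', ht'.nonneg, hz.2]
    · have : max z.1 τ' ≤ τ + 1 + z.1 := max_le (by linarith) (by linarith [hz.1])
      linarith
  -- Lowering the reward by `ε` gains at least `ε ∫ y` per cycle, which pays for the truncation loss
  -- in `g3`.
  have g4 : ε * ∫ y, y ∂ν ≤ ε * ∫ y, max y τ' ∂ν :=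
    mul_le_mul_of_nonneg_left (integral_le_integral_max hint τ') hε.le
  unfold gain at g1 ⊢
  linarith

end Rate

/-! ### Certificates for lower and upper bounds -/

section Certificates

variable {Ω : Type*} [MeasurableSpace Ω] {P : Measure Ω} [IsProbabilityMeasure P]
  {Y : ℕ → Ω → ℝ≥0} {S : ℕ → Ω → ℝ≥0∞} {r Q : ℝ → ℝ} {lam b : ℝ}

lemma prim_neg (r : ℝ → ℝ) (x : ℝ) : prim (fun s => -r s) x = -prim r x :=
  intervalIntegral.integral_neg

lemma prim_congr_nonneg {r r' : ℝ → ℝ} (h : ∀ x, 0 ≤ x → r x = r' x) {x : ℝ} (hx : 0 ≤ x) :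
    prim r x = prim r' x :=
  intervalIntegral.integral_congr fun s hs => h s (by
    rw [Set.uIcc_of_le hx] at hs
    exact hs.1)

lemma IsRate.prim_abs {ν : Measure ℝ} (h : IsRate r ν) {x : ℝ} (hx : 0 ≤ x) :
    prim (fun s => |r s|) x = prim r x :=
  prim_congr_nonneg (fun _ hx => abs_of_nonneg (h.zero ▸ h.mono hx)) hx

lemma IsRate.integrable_prim_abs (hY : ∀ i, Measurable (Y i)) (h : IsRate r (law P Y)) {T : ℝ}
    (hT : 0 ≤ T) : Integrable (fun y => prim (fun s => |r s|) (T + y)) (law P Y) := by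
  have := isProbabilityMeasure_law (P := P) hY
  have h0 := ae_law_nonneg (P := P) hY
  refine (h.integrable_prim h0 hT).congr ?_
  filter_upwards [h0] with y hy
  exact (h.prim_abs (by linarith)).symm

lemma samplingAge_nonneg (hS : IsCausal P Y S) {n : ℕ} {ω : Ω} (h : S n ω ≠ ∞) :
    0 ≤ samplingAge S n ω := by
  rw [samplingAge, sub_nonneg]
  exact ENNReal.toReal_mono h (sampling_mono hS.delivery_le ω (Nat.sub_le _ _))

lemma exists_bound_of_monotone (hQ : Monotone Q) (T : ℝ) :
    ∃ B, ∀ a ∈ Set.Icc 0 T, |Q a| ≤ B :=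
  ⟨max |Q 0| |Q T|, fun _ ha => abs_le_max_abs_abs (hQ ha.1) (hQ ha.2)⟩

lemma integrable_relValue {ν : Measure ℝ} [IsProbabilityMeasure ν] (hQ : Integrable Q ν)
    (hp : Integrable (prim r) ν) (hid : Integrable (fun y => y) ν) (b κ : ℝ) :
    Integrable (relValue r Q b κ) ν :=
  ((hQ.sub hp).add (hid.const_mul b)).add (integrable_const κ)

lemma integral_relValue {ν : Measure ℝ} [IsProbabilityMeasure ν] (hQ : Integrable Q ν)
    (hp : Integrable (prim r) ν) (hid : Integrable (fun y => y) ν) (b κ : ℝ) :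
    ∫ a, relValue r Q b κ a ∂ν = ∫ a, Q a ∂ν - ∫ a, prim r a ∂ν + b * ∫ y, y ∂ν + κ := by
  have h1 : Integrable (fun a => Q a - prim r a) ν := hQ.sub hp
  have h2 : Integrable (fun a => Q a - prim r a + b * a) ν := h1.add (hid.const_mul b)
  unfold relValue
  rw [integral_add h2 (integrable_const κ), integral_add h1 (hid.const_mul b),
    integral_sub hQ hp, integral_const_mul, integral_const, probReal_univ, one_smul]

/-- Certificate for the lower bound, when the rate function is bounded. -/
lemma IsRate.certificate (hY : ∀ i, Measurable (Y i))
    (hint : Integrable (fun ω => (Y 0 ω : ℝ)) P) (hS : IsCausal P Y S)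
    (h : IsRate r (law P Y)) {M : ℝ} (hM : ∀ x, r x ≤ M) (hQm : Monotone Q)
    (hQ : ∀ u, 0 ≤ u → Q u ≤ sampleCost r (law P Y) b u) (hQi : Integrable Q (law P Y))
    (hval : 0 ≤ ∫ y, Q y ∂(law P Y) - ∫ y, prim r y ∂(law P Y) + lam * ∫ y, y ∂(law P Y)) :
    Certificate P Y S r Q lam b := by
  have := isProbabilityMeasure_law (P := P) hY
  have h0 := ae_law_nonneg (P := P) hY
  have hid := integrable_law_id hY hint
  have hp0 : Integrable (prim r) (law P Y) := by simpa using h.integrable_prim h0 le_rfl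
  have hM0 : 0 ≤ M := h.zero ▸ hM 0
  have hlip : ∀ x y, 0 ≤ y → prim r (x + y) - prim r x ≤ M * y := by
    intro x y hy
    have h1 := prim_sub_le h.cont h.mono (show x ≤ x + y by linarith)
    have h2 := mul_le_mul_of_nonneg_left (hM (x + y)) hy
    rw [add_sub_cancel_left] at h1
    linarith
  refine ⟨h.cont, hQm.measurable, exists_bound_of_monotone hQm, ?_, ?_,
    fun T hT => h.integrable_prim_abs hY hT, fun n ω a _ ha _ => hQm ha, fun n ω hn => ?_, ?_, ?_⟩
  -- Bounded rate: one more service raises the accumulated penalty by at most `M` times its length,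
  -- uniformly in the age `a`. An unbounded rate need not allow such a bound.
  · refine ⟨M * ∫ y, y ∂(law P Y) + (lam - b) * ∫ y, y ∂(law P Y), fun a ha => ?_⟩
    have h1 := hQ a ha
    have h2 : ∫ y, (prim r (a + y) - prim r a) ∂(law P Y) ≤ M * ∫ y, y ∂(law P Y) := by
      rw [← integral_const_mul]
      refine integral_mono_ae ((h.integrable_prim h0 ha).sub (integrable_const _))
        (hid.const_mul M) ?_
      filter_upwards [h0] with y hy
      exact hlip a y hy
    rw [integral_sub (h.integrable_prim h0 ha) (integrable_const _), integral_const,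
      probReal_univ, one_smul] at h2
    unfold sampleCost at h1
    unfold relValue
    linarith
  · refine ⟨M + |lam - b|, by positivity, fun x y hx hy => ?_⟩
    have h1 := hlip x y hy
    have h2 := mul_le_mul_of_nonneg_right (le_abs_self (lam - b)) hy
    unfold serviceCost
    linarith
  · exact hQ _ (samplingAge_nonneg hS hn)
  · exact integrable_relValue hQi hp0 hid _ _
  · rw [integral_relValue hQi hp0 hid]
    linarith

/-- After the change of sign the penalty part of a service is nonpositive, so only the activation
cost and the reward matter, and no bound on `r` is needed. -/
lemma IsRate.overshoot_neg {ν : Measure ℝ} (h : IsRate r ν) (lam b : ℝ) :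
    ∃ K, 0 ≤ K ∧ ∀ x y, 0 ≤ x → 0 ≤ y →
      serviceCost (fun s => -r s) (-lam) (-b) x y ≤ K * y := by
  refine ⟨|-lam - -b|, abs_nonneg _, fun x y hx hy => ?_⟩
  have h1 := prim_mono h.cont h.mono h.zero hx (show x ≤ x + y by linarith)
  have h2 := mul_le_mul_of_nonneg_right (le_abs_self (-lam - -b)) hy
  rw [serviceCost, prim_neg, prim_neg]
  linarith

/-- Certificate for the upper bound, for the threshold policy. -/
lemma IsRate.certificate_neg (hY : ∀ i, Measurable (Y i))
    (hint : Integrable (fun ω => (Y 0 ω : ℝ)) P) (h : IsRate r (law P Y)) {τ : ℝ}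
    (ht : IsThreshold r (law P Y) b τ)
    (hsucc : ∀ n ω, S (n + 1) ω = S n ω + max (Y n ω : ℝ≥0∞) (ENNReal.ofReal τ))
    (hg : gain r (law P Y) lam b τ ≤ 0) :
    Certificate P Y S (fun x => -r x) (fun a => -sampleCost r (law P Y) b (max a τ))
      (-lam) (-b) := by
  have := isProbabilityMeasure_law (P := P) hY
  have h0 := ae_law_nonneg (P := P) hY
  have hid := integrable_law_id hY hint
  have hp0 : Integrable (prim r) (law P Y) := by simpa using h.integrable_prim h0 le_rfl
  have hpn : Integrable (prim fun s => -r s) (law P Y) :=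
    hp0.neg.congr (ae_of_all _ fun y => (prim_neg r y).symm)
  have hmono : Monotone fun a => sampleCost r (law P Y) b (max a τ) := fun a a' haa =>
    h.sampleCost_mono h0 ht (le_max_right _ _) (max_le_max_right _ haa)
  have hQi := h.integrable_sampleCost_max h0 hid b ht.nonneg
  have hτ := ht.nonneg
  have hmax : ∀ n ω, max (Y n ω : ℝ≥0∞) (ENNReal.ofReal τ) = ENNReal.ofReal (max (Y n ω : ℝ) τ) :=
    fun n ω => by rw [ENNReal.ofReal_max, ENNReal.ofReal_coe_nnreal]
  refine ⟨h.cont.neg, hmono.measurable.neg, fun T => ?_, ?_, h.overshoot_neg lam b, fun T hT => ?_,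
    fun n ω a hn ha hle => ?_, fun n ω hn => ?_, ?_, ?_⟩
  · obtain ⟨B, hB⟩ := exists_bound_of_monotone hmono T
    exact ⟨B, fun a ha => by rw [abs_neg]; exact hB a ha⟩
  -- For `a ≥ τ` the estimate `prim r a ≤ ∫ prim r (a + y)` suffices; for `a ≤ τ` every term is
  -- bounded by its size on `[0, τ]`.
  · refine ⟨|(-lam - -b) * ∫ y, y ∂(law P Y)| + prim r τ + |b| * τ +
      |sampleCost r (law P Y) b τ|, fun a ha => ?_⟩
    have hpτ := prim_nonneg h.cont h.mono h.zero τ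
    have h2 := le_abs_self ((-lam - -b) * ∫ y, y ∂(law P Y))
    have h3 := neg_abs_le (sampleCost r (law P Y) b τ)
    have h4 := abs_nonneg (sampleCost r (law P Y) b τ)
    have h5 : 0 ≤ |b| * τ := by positivity
    rw [relValue, prim_neg]
    rcases le_total τ a with hτa | hτa
    · rw [max_eq_left hτa]
      have h1 : prim r a ≤ ∫ y, prim r (a + y) ∂(law P Y) := by
        calc prim r a = ∫ _, prim r a ∂(law P Y) := by simp
          _ ≤ _ := by
            refine integral_mono_ae (integrable_const _) (h.integrable_prim h0 ha) ?_
            filter_upwards [h0] with y hy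
            exact prim_mono h.cont h.mono h.zero ha (by linarith)
      unfold sampleCost at h3 h4 ⊢
      linarith
    · rw [max_eq_right hτa]
      have h1 := prim_mono h.cont h.mono h.zero ha hτa
      have h6 : -b * a ≤ |b| * τ :=
        (mul_le_mul_of_nonneg_right (neg_le_abs b) ha).trans
          (mul_le_mul_of_nonneg_left hτa (abs_nonneg b))
      linarith
  · simpa only [abs_neg] using h.integrable_prim_abs hY hT
  · rw [hsucc, hmax, ENNReal.add_le_add_iff_left hn,
      ENNReal.ofReal_le_ofReal_iff (ht.nonneg.trans (le_max_right _ _))] at hle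
    have : max a τ = max (Y n ω : ℝ) τ :=
      le_antisymm (max_le hle (le_max_right _ _)) (max_le_max_right _ ha)
    simp only [this, le_refl]
  · have hn' : S n ω ≠ ∞ := by
      intro hc
      rw [hsucc, hc, top_add] at hn
      exact hn rfl
    have hu : samplingAge S (n + 1) ω = max (Y n ω : ℝ) τ := by
      rw [samplingAge, Nat.add_sub_cancel, hsucc, hmax, ENNReal.toReal_add hn'
        ENNReal.ofReal_ne_top, ENNReal.toReal_ofReal (ht.nonneg.trans (le_max_right _ _)),
        add_sub_cancel_left]
    rw [hu, max_eq_left (le_max_right (Y n ω : ℝ) τ)]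
    simp only [prim_neg, integral_neg, sampleCost]
    linarith
  · exact integrable_relValue hQi.neg hpn hid _ _
  · rw [h.gain_eq h0 hid lam b ht.nonneg] at hg
    have hQn : Integrable (fun a => -sampleCost r (law P Y) b (max a τ)) (law P Y) := hQi.neg
    rw [integral_relValue hQn hpn hid]
    simp only [prim_neg, integral_neg]
    linarith

/-- Certificate for the upper bound, for the policy that never samples again. -/
lemma IsRate.certificate_neg_of_never (hY : ∀ i, Measurable (Y i))
    (hint : Integrable (fun ω => (Y 0 ω : ℝ)) P) (h : IsRate r (law P Y)) (hb : ∀ x, r x ≤ b)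
    (hsucc : ∀ n ω, S (n + 1) ω = ∞) (lam : ℝ) :
    Certificate P Y S (fun x => -r x) (fun _ => |lam| * ∫ y, y ∂(law P Y)) (-lam) (-b) := by
  have := isProbabilityMeasure_law (P := P) hY
  have h0 := ae_law_nonneg (P := P) hY
  have hid := integrable_law_id hY hint
  have hp0 : Integrable (prim r) (law P Y) := by simpa using h.integrable_prim h0 le_rfl
  have hpn : Integrable (prim fun s => -r s) (law P Y) :=
    hp0.neg.congr (ae_of_all _ fun y => (prim_neg r y).symm)
  have hQi : Integrable (fun _ : ℝ => |lam| * ∫ y, y ∂(law P Y)) (law P Y) := integrable_const _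
  -- Nothing is sampled after sample `0`, so the field `sample` is vacuous. The constant `Q` only
  -- has to be large enough for `value_nonneg`.
  refine ⟨h.cont.neg, measurable_const, fun T => ⟨_, fun a _ => le_rfl⟩, ?_,
    h.overshoot_neg lam b, fun T hT => ?_, fun n ω a _ _ _ => le_rfl,
    fun n ω hn => absurd (hsucc n ω) hn, ?_, ?_⟩
  · refine ⟨|lam| * ∫ y, y ∂(law P Y) + (-lam - -b) * ∫ y, y ∂(law P Y), fun a ha => ?_⟩
    have h1 := prim_sub_le h.cont h.mono ha
    have h2 := mul_le_mul_of_nonneg_left (hb a) ha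
    rw [prim_zero, sub_zero, sub_zero] at h1
    rw [relValue, prim_neg]
    linarith
  · simpa only [abs_neg] using h.integrable_prim_abs hY hT
  · exact integrable_relValue hQi hpn hid _ _
  · rw [integral_relValue hQi hpn hid, integral_const, probReal_univ, one_smul]
    simp only [prim_neg, integral_neg]
    have h1 : 0 ≤ ∫ y, prim r y ∂(law P Y) :=
      integral_nonneg fun y => prim_nonneg h.cont h.mono h.zero y
    have h2 : 0 ≤ ∫ y, y ∂(law P Y) := integral_nonneg_of_ae h0
    have h3 := mul_le_mul_of_nonneg_right (le_abs_self lam) h2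
    linarith

/-- Through this identity the verification theorem for the negated problem becomes an upper bound.
-/
lemma meanCost_neg (r : ℝ → ℝ) (lam T : ℝ) :
    meanCost P (fun x => -r x) (-lam) Y S T = -meanCost P r lam Y S T := by
  unfold meanCost
  rw [← integral_neg]
  congr 1
  funext ω
  rw [← mul_neg, ← intervalIntegral.integral_neg]
  congr 2
  funext t
  ring

lemma meanCost_mono {r' : ℝ → ℝ} (hr : Continuous r) (hr' : Continuous r')
    (hle : ∀ x, r' x ≤ r x) (hY : ∀ i, Measurable (Y i)) (hS : ∀ i, Measurable (S i)) {T : ℝ}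
    (hT : 0 < T) : meanCost P r' lam Y S T ≤ meanCost P r lam Y S T := by
  rw [meanCost_eq (b := 0) hr hY hS hT, meanCost_eq (b := 0) hr' hY hS hT]
  gcongr
  · exact integrable_integral_runningCost hr' lam 0 hY hS hT.le
  · exact integrable_integral_runningCost hr lam 0 hY hS hT.le
  · intro ω
    refine intervalIntegral.integral_mono_on hT.le
      (intervalIntegrable_runningCost hr' lam 0 hY hS ω le_rfl hT.le)
      (intervalIntegrable_runningCost hr lam 0 hY hS ω le_rfl hT.le) fun t _ => ?_
    have := hle (age Y S t ω)
    unfold runningCost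
    linarith

lemma coe_le_limsup {f : ℝ → ℝ} {b : ℝ} (h : ∀ ε, 0 < ε → ∀ᶠ T in atTop, b - ε ≤ f T) :
    (b : EReal) ≤ limsup (fun T => (f T : EReal)) atTop := by
  rw [← EReal.ge_of_forall_gt_iff_ge]
  intro z hz
  have hz' : z < b := EReal.coe_lt_coe_iff.1 hz
  refine le_limsup_of_frequently_le (Eventually.frequently ?_)
  filter_upwards [h (b - z) (sub_pos.2 hz')] with T hT
  exact EReal.coe_le_coe_iff.2 (by linarith)

lemma limsup_le_coe {f : ℝ → ℝ} {b : ℝ} (h : ∀ ε, 0 < ε → ∀ᶠ T in atTop, -b - ε ≤ -f T) :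
    limsup (fun T => (f T : EReal)) atTop ≤ (b : EReal) := by
  rw [← EReal.le_of_forall_lt_iff_le]
  intro z hz
  have hz' : b < z := EReal.coe_lt_coe_iff.1 hz
  refine limsup_le_of_le (by isBoundedDefault) ?_
  filter_upwards [h (z - b) (sub_pos.2 hz')] with T hT
  exact EReal.coe_le_coe_iff.2 (by linarith)

end Certificates

/-! ### Threshold policies as policies with a fixed sampling age -/

section Threshold

variable {Ω : Type*} [MeasurableSpace Ω] {P : Measure Ω} [IsProbabilityMeasure P]
  {Y : ℕ → Ω → ℝ≥0} {S : ℕ → Ω → ℝ≥0∞}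

/-- Policies that sample as soon as the age reaches a fixed level are causal. -/
lemma isCausal_of_succ (hY : ∀ i, Measurable (Y i)) (hindep : iIndepFun Y P)
    (h0 : ∀ ω, S 0 ω = 0) (τ : ℝ≥0∞)
    (hsucc : ∀ n ω, S (n + 1) ω = S n ω + max (Y n ω : ℝ≥0∞) τ) : IsCausal P Y S := by
  -- `S n` is a function of `Y 0, …, Y (n - 1)`, so sampling times up to `i + 1` add nothing to `Y
  -- 0, …, Y i`. Causality then follows from independence of disjoint blocks.
  have key : ∀ n i, n ≤ i + 1 →
      Measurable[⨆ j ∈ Set.Iic i, MeasurableSpace.comap (Y j) inferInstance] (S n) := by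
    intro n i
    induction n with
    | zero =>
      intro _
      rw [show S 0 = fun _ => 0 from funext h0]
      exact measurable_const
    | succ n ih =>
      intro hn
      have hYn : Measurable[⨆ j ∈ Set.Iic i, MeasurableSpace.comap (Y j) inferInstance] (Y n) := by
        rw [measurable_iff_comap_le]
        exact le_iSup₂_of_le (f := fun j (_ : j ∈ Set.Iic i) =>
          MeasurableSpace.comap (Y j) inferInstance) n (by simpa using hn) le_rfl
      rw [show S (n + 1) = fun ω => S n ω + max (Y n ω : ℝ≥0∞) τ from funext (hsucc n)]
      exact (ih (by omega)).add (hYn.coe_nnreal_ennreal.max measurable_const)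
  have hle : ∀ i, MeasurableSpace.comap (Y i) inferInstance ≤ (inferInstance : MeasurableSpace Ω) :=
    fun i => (hY i).comap_le
  refine ⟨fun n => (key n n (Nat.le_succ n)).mono (iSup₂_le fun j _ => hle j) le_rfl, h0,
    fun i ω => ?_, fun i => ?_⟩
  · rw [hsucc, delivery]
    gcongr
    exact le_max_left _ _
  · have hind := indep_iSup_of_disjoint hle hindep.iIndep (S := Set.Iic i) (T := Set.Ioi i)
      (Set.Iic_disjoint_Ioi le_rfl)
    refine indep_of_indep_of_le_left hind (sup_le le_rfl (iSup₂_le fun j hj => ?_))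
    rw [← measurable_iff_comap_le]
    exact key j i hj

/-- The weighted penalty rate. -/
def weightedPenalty (θ σ w x : ℝ) : ℝ := w * penalty θ σ x

lemma deliveryRate_weightedPenalty (hY : ∀ i, Measurable (Y i))
    (hident : ∀ i, IdentDistrib (Y i) (Y 0) P P) (θ σ w : ℝ)
    (hc : Continuous (weightedPenalty θ σ w)) (i : ℕ) (x : ℝ) :
    w * ∫ ω', penalty θ σ (x + Y i ω') ∂P =
      deliveryRate (weightedPenalty θ σ w) (law P Y) x := by
  rw [deliveryRate, ← integral_comp_transmission hY hident (g := fun y =>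
    weightedPenalty θ σ w (x + y)) (Continuous.measurable (by fun_prop)) i, ← integral_const_mul]
  rfl

variable {θ σ w b : ℝ}

lemma threshold_succ (hY : ∀ i, Measurable (Y i))
    (hident : ∀ i, IdentDistrib (Y i) (Y 0) P P)
    (hc : Continuous (weightedPenalty θ σ w)) {τ : ℝ}
    (ht : IsThreshold (weightedPenalty θ σ w) (law P Y) b τ) (n : ℕ) (ω : Ω) :
    threshold P θ σ w Y b (n + 1) ω =
      threshold P θ σ w Y b n ω + max (Y n ω : ℝ≥0∞) (ENNReal.ofReal τ) := by
  rw [threshold]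
  simp only [deliveryRate_weightedPenalty hY hident θ σ w hc]
  set s := threshold P θ σ w Y b n ω
  apply le_antisymm
  -- The infimum is approached from strictly above, because the rate at `τ` itself may or may not
  -- reach `b`.
  · refine le_of_forall_gt_imp_ge_of_dense fun c hlt => ?_
    rcases eq_or_ne c ∞ with rfl | hctop
    · exact le_top
    refine sInf_le ⟨hctop, (add_le_add_right (le_max_left _ _) s).trans hlt.le, ht.le _ ?_⟩
    have h1 : ENNReal.ofReal τ < c - s :=
      lt_tsub_iff_left.2 ((add_le_add_right (le_max_right _ _) s).trans_lt hlt)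
    exact (ENNReal.ofReal_lt_iff_lt_toReal ht.nonneg (ENNReal.sub_ne_top hctop)).1 h1
  · refine le_sInf fun t htt => ?_
    obtain ⟨h1, h2, h3⟩ := htt
    have hs : s ≤ t := le_self_add.trans h2
    have hsfin : s ≠ ∞ := ne_top_of_le_ne_top h1 hs
    rw [← add_tsub_cancel_of_le hs]
    gcongr
    refine max_le (ENNReal.le_sub_of_add_le_left hsfin h2) ?_
    rw [ENNReal.ofReal_le_iff_le_toReal (ENNReal.sub_ne_top h1)]
    by_contra hlt
    exact absurd h3 (not_le.2 (ht.lt _ ENNReal.toReal_nonneg (not_le.1 hlt)))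

lemma threshold_succ_eq_top (hY : ∀ i, Measurable (Y i))
    (hident : ∀ i, IdentDistrib (Y i) (Y 0) P P)
    (hc : Continuous (weightedPenalty θ σ w))
    (hlt : ∀ x, 0 ≤ x → deliveryRate (weightedPenalty θ σ w) (law P Y) x < b) (n : ℕ) (ω : Ω) :
    threshold P θ σ w Y b (n + 1) ω = ∞ := by
  rw [threshold]
  simp only [deliveryRate_weightedPenalty hY hident θ σ w hc]
  rw [sInf_eq_top]
  rintro t ⟨-, -, h3⟩
  exact absurd h3 (not_le.2 (hlt _ ENNReal.toReal_nonneg))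

lemma ne_top_of_succ (h0 : ∀ ω, S 0 ω = 0) {τ : ℝ}
    (hsucc : ∀ n ω, S (n + 1) ω = S n ω + max (Y n ω : ℝ≥0∞) (ENNReal.ofReal τ)) (n : ℕ) (ω : Ω) :
    S n ω ≠ ∞ := by
  induction n with
  | zero => simp [h0]
  | succ n ih =>
    rw [hsucc]
    exact ENNReal.add_ne_top.2 ⟨ih, by simp⟩

lemma toReal_succ (h0 : ∀ ω, S 0 ω = 0) {τ : ℝ} (hτ : 0 ≤ τ)
    (hsucc : ∀ n ω, S (n + 1) ω = S n ω + max (Y n ω : ℝ≥0∞) (ENNReal.ofReal τ)) (n : ℕ) (ω : Ω) :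
    (S (n + 1) ω).toReal = (S n ω).toReal + max (Y n ω : ℝ) τ := by
  have hmax : max (Y n ω : ℝ≥0∞) (ENNReal.ofReal τ) = ENNReal.ofReal (max (Y n ω : ℝ) τ) := by
    rw [ENNReal.ofReal_max, ENNReal.ofReal_coe_nnreal]
  rw [hsucc, hmax, ENNReal.toReal_add (ne_top_of_succ h0 hsucc n ω) ENNReal.ofReal_ne_top,
    ENNReal.toReal_ofReal (hτ.trans (le_max_right _ _))]

lemma cycleLength_eq (h0 : ∀ ω, S 0 ω = 0) {τ : ℝ} (hτ : 0 ≤ τ)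
    (hsucc : ∀ n ω, S (n + 1) ω = S n ω + max (Y n ω : ℝ≥0∞) (ENNReal.ofReal τ)) (n : ℕ) (ω : Ω) :
    cycleLength Y S n ω = max (Y n ω : ℝ) τ + Y (n + 1) ω - Y n ω := by
  rw [cycleLength, toReal_delivery (ne_top_of_succ h0 hsucc _ ω),
    toReal_delivery (ne_top_of_succ h0 hsucc _ ω), toReal_succ h0 hτ hsucc]
  ring

lemma cycleCost_eq (hY : ∀ i, Measurable (Y i)) (hS : IsCausal P Y S)
    (hc : Continuous (weightedPenalty θ σ w)) {τ : ℝ} (hτ : 0 ≤ τ)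
    (hsucc : ∀ n ω, S (n + 1) ω = S n ω + max (Y n ω : ℝ≥0∞) (ENNReal.ofReal τ)) (n : ℕ) (ω : Ω) :
    cycleCost θ σ w Y S n ω = prim (weightedPenalty θ σ w) (max (Y n ω : ℝ) τ + Y (n + 1) ω)
      - prim (weightedPenalty θ σ w) (Y n ω) := by
  have hn := ne_top_of_succ hS.zero hsucc n ω
  have hn1 := ne_top_of_succ hS.zero hsucc (n + 1) ω
  have hs := toReal_succ hS.zero hτ hsucc n ω
  have hy : (0 : ℝ) ≤ Y n ω := (Y n ω).coe_nonneg
  have hy1 : (0 : ℝ) ≤ Y (n + 1) ω := (Y (n + 1) ω).coe_nonneg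
  have hs0 : 0 ≤ (S n ω).toReal := ENNReal.toReal_nonneg
  have hs1 : 0 ≤ (S (n + 1) ω).toReal := ENNReal.toReal_nonneg
  -- With zero activation cost and zero reward the running cost is the penalty. The age is not reset
  -- at `S (n + 1)`, so the waiting and service pieces join into one increment of `prim`.
  have e : ∀ t, w * penalty θ σ (age Y S t ω) =
      runningCost (weightedPenalty θ σ w) 0 0 Y S t ω := fun t => by
    simp [runningCost, weightedPenalty]
  have hD : ENNReal.ofReal ((S n ω).toReal + Y n ω) = delivery Y S n ω := by
    rw [ENNReal.ofReal_add hs0 hy, ENNReal.ofReal_toReal hn, ENNReal.ofReal_coe_nnreal, delivery]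
  have hD1 : ENNReal.ofReal ((S (n + 1) ω).toReal + Y (n + 1) ω) = delivery Y S (n + 1) ω := by
    rw [ENNReal.ofReal_add hs1 hy1, ENNReal.ofReal_toReal hn1, ENNReal.ofReal_coe_nnreal, delivery]
  have hle : (S n ω).toReal + Y n ω ≤ (S (n + 1) ω).toReal := by
    rw [hs]
    linarith [le_max_left (Y n ω : ℝ) τ]
  rw [cycleCost, toReal_delivery hn, toReal_delivery hn1]
  simp only [e]
  rw [← intervalIntegral.integral_add_adjacent_intervals
    (intervalIntegrable_runningCost hc 0 0 hY hS.measurable ω (by positivity) hs1)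
    (intervalIntegrable_runningCost hc 0 0 hY hS.measurable ω hs1 (by positivity)),
    integral_runningCost_waiting hc 0 0 hS.delivery_le (by positivity) hle hD.ge
      (ENNReal.ofReal_toReal hn1).le,
    integral_runningCost_in_service hc 0 0 hS.zero hS.delivery_le hs1 (by linarith)
      (ENNReal.ofReal_toReal hn1).ge hD1.le, Nat.add_sub_cancel, hs,
    show (S n ω).toReal + max (Y n ω : ℝ) τ + Y (n + 1) ω - (S n ω).toReal =
      max (Y n ω : ℝ) τ + Y (n + 1) ω by ring, add_sub_cancel_left, add_sub_cancel_left]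
  ring

/-- Consecutive transmission times have the product law. -/
lemma map_pair (hY : ∀ i, Measurable (Y i)) (hindep : iIndepFun Y P)
    (hident : ∀ i, IdentDistrib (Y i) (Y 0) P P) (n : ℕ) :
    P.map (fun ω => ((Y n ω : ℝ), (Y (n + 1) ω : ℝ))) = (law P Y).prod (law P Y) := by
  have hi : IndepFun (fun ω => (Y n ω : ℝ)) (fun ω => (Y (n + 1) ω : ℝ)) P :=
    (hindep.indepFun (Nat.succ_ne_self n).symm).comp measurable_coe_nnreal_real
      measurable_coe_nnreal_real
  rw [(indepFun_iff_map_prod_eq_prod_map_map (hY n).coe_nnreal_real.aemeasurable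
    (hY (n + 1)).coe_nnreal_real.aemeasurable).1 hi, map_eq_law hident, map_eq_law hident]

lemma integrable_pair_iff (hY : ∀ i, Measurable (Y i)) (hindep : iIndepFun Y P)
    (hident : ∀ i, IdentDistrib (Y i) (Y 0) P P) (n : ℕ) {f : ℝ × ℝ → ℝ} (hf : Continuous f) :
    Integrable (fun ω => f (Y n ω, Y (n + 1) ω)) P ↔
      Integrable f ((law P Y).prod (law P Y)) := by
  rw [← map_pair hY hindep hident n]
  exact (integrable_map_measure hf.aestronglyMeasurable
    ((hY n).coe_nnreal_real.prodMk (hY (n + 1)).coe_nnreal_real).aemeasurable).symm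

lemma integral_pair (hY : ∀ i, Measurable (Y i)) (hindep : iIndepFun Y P)
    (hident : ∀ i, IdentDistrib (Y i) (Y 0) P P) (n : ℕ) {f : ℝ × ℝ → ℝ} (hf : Continuous f) :
    ∫ ω, f (Y n ω, Y (n + 1) ω) ∂P = ∫ z, f z ∂((law P Y).prod (law P Y)) := by
  rw [← map_pair hY hindep hident n]
  exact (integral_map ((hY n).coe_nnreal_real.prodMk
    (hY (n + 1)).coe_nnreal_real).aemeasurable hf.aestronglyMeasurable).symm

/-- Expected length and cost of a cycle of the threshold policy. -/
lemma cycle_expectations (hY : ∀ i, Measurable (Y i)) (hindep : iIndepFun Y P)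
    (hident : ∀ i, IdentDistrib (Y i) (Y 0) P P)
    (hint : Integrable (fun ω => (Y 0 ω : ℝ)) P) (hS : IsCausal P Y S)
    (hr : IsRate (weightedPenalty θ σ w) (law P Y)) {τ : ℝ} (hτ : 0 ≤ τ)
    (hsucc : ∀ n ω, S (n + 1) ω = S n ω + max (Y n ω : ℝ≥0∞) (ENNReal.ofReal τ)) (lam b : ℝ)
    (n : ℕ) :
    Integrable (cycleLength Y S n) P ∧ Integrable (cycleCost θ σ w Y S n) P ∧
      ∫ ω, cycleLength Y S n ω ∂P = ∫ y, max y τ ∂(law P Y) ∧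
      ∫ ω, cycleCost θ σ w Y S n ω ∂P + lam * ∫ ω, (Y (n + 1) ω : ℝ) ∂P
        - b * ∫ ω, cycleLength Y S n ω ∂P =
        gain (weightedPenalty θ σ w) (law P Y) lam b τ := by
  have := isProbabilityMeasure_law (P := P) hY
  have h0 := ae_law_nonneg (P := P) hY
  have hid := integrable_law_id hY hint
  have hp := continuous_prim hr.cont
  have hL : cycleLength Y S n = fun ω => max (Y n ω : ℝ) τ + Y (n + 1) ω - Y n ω :=
    funext (cycleLength_eq hS.zero hτ hsucc n)
  have hC : cycleCost θ σ w Y S n = fun ω =>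
      prim (weightedPenalty θ σ w) (max (Y n ω : ℝ) τ + Y (n + 1) ω)
        - prim (weightedPenalty θ σ w) (Y n ω) :=
    funext (cycleCost_eq hY hS hr.cont hτ hsucc n)
  have i1 := integrable_comp_transmission hY hident (integrable_max hid τ) n
  have i2 := fun n => integrable_comp_transmission hY hident hid n
  have i12 : Integrable (fun ω => max (Y n ω : ℝ) τ + Y (n + 1) ω) P := i1.add (i2 (n + 1))
  have hf : Continuous fun z : ℝ × ℝ => prim (weightedPenalty θ σ w) (max z.1 τ + z.2) := by
    fun_prop
  have i3 := (integrable_pair_iff hY hindep hident n hf).2 (hr.integrable_prim_max h0 hτ)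
  have i4 := integrable_comp_transmission hY hident
    (g := prim (weightedPenalty θ σ w)) (by simpa using hr.integrable_prim h0 le_rfl) n
  have e1 := integral_comp_transmission hY hident (g := fun y => max y τ)
    (measurable_id.max measurable_const) n
  have e2 := fun n => integral_comp_transmission hY hident (g := fun y => y) measurable_id n
  have e3 := integral_pair hY hindep hident n hf
  have e4 := integral_comp_transmission hY hident hp.measurable n
  have eL : ∫ ω, cycleLength Y S n ω ∂P = ∫ y, max y τ ∂(law P Y) := by
    rw [hL, integral_sub i12 (i2 n), integral_add i1 (i2 (n + 1)), e1, e2, e2,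
      add_sub_cancel_right]
  refine ⟨?_, ?_, eL, ?_⟩
  · rw [hL]
    exact i12.sub (i2 n)
  · rw [hC]
    exact i3.sub i4
  · rw [eL, hC, integral_sub i3 i4, e3, e4, e2, gain]

end Threshold

/-! ### The penalty function -/

section Penalty

variable {θ σ : ℝ}

lemma continuous_penalty : Continuous (penalty θ σ) := by
  unfold penalty
  split_ifs <;> fun_prop

lemma penalty_zero : penalty θ σ 0 = 0 := by
  unfold penalty
  split_ifs <;> simp

lemma penalty_mono : Monotone (penalty θ σ) := by
  intro x y hxy
  unfold penalty
  split_ifs with h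
  · exact mul_le_mul_of_nonneg_left hxy (sq_nonneg σ)
  · rcases lt_or_gt_of_ne h with h | h
    · have h1 : Real.exp (-2 * θ * x) ≤ Real.exp (-2 * θ * y) :=
        Real.exp_le_exp.2 (by nlinarith)
      exact mul_le_mul_of_nonpos_left (by linarith)
        (div_nonpos_of_nonneg_of_nonpos (sq_nonneg σ) (by linarith))
    · have h1 : Real.exp (-2 * θ * y) ≤ Real.exp (-2 * θ * x) :=
        Real.exp_le_exp.2 (by nlinarith)
      exact mul_le_mul_of_nonneg_left (by linarith) (by positivity)

/-- This functional equation holds for all `θ`, including `0`. Integrated, it carries the finiteness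
assumption for two transmissions over to an arbitrary initial age `c`, as `IsRate` requires. -/
lemma penalty_add (x c : ℝ) :
    penalty θ σ (x + c) = Real.exp (-2 * θ * c) * penalty θ σ x + penalty θ σ c := by
  unfold penalty
  split_ifs with h
  · subst h
    simp
    ring
  · rw [mul_add, Real.exp_add]
    ring

lemma prim_penalty_add (x c : ℝ) :
    prim (penalty θ σ) (c + x) = prim (penalty θ σ) c
      + (Real.exp (-2 * θ * c) * prim (penalty θ σ) x + penalty θ σ c * x) := by
  have h1 := integral_eq_prim_sub (continuous_penalty (θ := θ) (σ := σ)) c (c + x)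
  have h2 : ∫ s in c..(c + x), penalty θ σ s = ∫ s in (0 : ℝ)..x, penalty θ σ (s + c) := by
    rw [intervalIntegral.integral_comp_add_right (fun s => penalty θ σ s), zero_add, add_comm c x]
  simp only [penalty_add] at h2
  rw [intervalIntegral.integral_add ((continuous_penalty.const_mul _).intervalIntegrable _ _)
    (by simp), intervalIntegral.integral_const_mul, intervalIntegral.integral_const, smul_eq_mul,
    sub_zero] at h2
  rw [h1] at h2
  unfold prim at h2 ⊢
  linarith

lemma prim_weightedPenalty (w x : ℝ) :
    prim (weightedPenalty θ σ w) x = w * prim (penalty θ σ) x :=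
  intervalIntegral.integral_const_mul _ _

lemma isRate_weightedPenalty {Ω : Type*} [MeasurableSpace Ω] {P : Measure Ω}
    [IsProbabilityMeasure P] {Y : ℕ → Ω → ℝ≥0} (hY : ∀ i, Measurable (Y i))
    (hindep : iIndepFun Y P) (hident : ∀ i, IdentDistrib (Y i) (Y 0) P P)
    (hint : Integrable (fun ω => (Y 0 ω : ℝ)) P) {w : ℝ} (hw : 0 ≤ w)
    (hfin : Integrable
      (fun ω => ∫ s in (0 : ℝ)..((Y 0 ω : ℝ) + (Y 1 ω : ℝ)), penalty θ σ s) P) :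
    IsRate (weightedPenalty θ σ w) (law P Y) := by
  have := isProbabilityMeasure_law (P := P) hY
  have hp := continuous_prim (continuous_penalty (θ := θ) (σ := σ))
  refine ⟨continuous_const.mul continuous_penalty,
    fun x y hxy => mul_le_mul_of_nonneg_left (penalty_mono hxy) hw,
    by simp [weightedPenalty, penalty_zero], fun c _ => ?_⟩
  have h1 : Integrable (fun z : ℝ × ℝ => prim (penalty θ σ) (z.1 + z.2))
      ((law P Y).prod (law P Y)) :=
    (integrable_pair_iff hY hindep hident 0 (by fun_prop)).1 hfin
  have hid := integrable_law_id hY hint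
  have h2 : Integrable (fun z : ℝ × ℝ => z.1 + z.2) ((law P Y).prod (law P Y)) :=
    (hid.comp_fst _).add (hid.comp_snd _)
  have h3 : ∀ z : ℝ × ℝ, prim (weightedPenalty θ σ w) (c + z.1 + z.2) = w * (prim (penalty θ σ) c
      + (Real.exp (-2 * θ * c) * prim (penalty θ σ) (z.1 + z.2) + penalty θ σ c * (z.1 + z.2))) :=
    fun z => by rw [prim_weightedPenalty, add_assoc, prim_penalty_add]
  simp only [h3]
  exact ((integrable_const _).add ((h1.const_mul _).add (h2.const_mul _))).const_mul w

end Penalty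

/-! ### Behaviour at large ages and negative gain -/

section Limits

variable {θ σ w : ℝ}

/-- From `1 + x ≤ exp x`, divided by `2 * θ < 0`. The linear growth makes every reward level
attainable. -/
lemma le_penalty_of_nonpos (hθ : θ ≤ 0) (x : ℝ) : σ ^ 2 * x ≤ penalty θ σ x := by
  unfold penalty
  split_ifs with h
  · exact le_rfl
  · have hneg : 2 * θ < 0 := by
      have := lt_of_le_of_ne hθ h
      linarith
    have h1 := Real.add_one_le_exp (-2 * θ * x)
    have h2 : x * (2 * θ) ≥ 1 - Real.exp (-2 * θ * x) := by linarith
    have h3 : x ≤ (1 - Real.exp (-2 * θ * x)) / (2 * θ) := by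
      rw [le_div_iff_of_neg hneg]
      exact h2
    calc σ ^ 2 * x ≤ σ ^ 2 * ((1 - Real.exp (-2 * θ * x)) / (2 * θ)) :=
          mul_le_mul_of_nonneg_left h3 (sq_nonneg σ)
      _ = _ := by ring

lemma weightedPenalty_of_pos (hθ : 0 < θ) (x : ℝ) :
    weightedPenalty θ σ w x = w * σ ^ 2 / (2 * θ) * (1 - Real.exp (-2 * θ * x)) := by
  rw [weightedPenalty, penalty, if_neg hθ.ne']
  ring

lemma prim_weightedPenalty_of_pos (hθ : 0 < θ) (x : ℝ) :
    prim (weightedPenalty θ σ w) x = w * σ ^ 2 / (2 * θ) * (x - 1 / (2 * θ))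
      + w * σ ^ 2 / (4 * θ ^ 2) * Real.exp (-2 * θ * x) := by
  have hd : ∀ t, HasDerivAt (fun x => w * σ ^ 2 / (2 * θ) * (x - 1 / (2 * θ))
      + w * σ ^ 2 / (4 * θ ^ 2) * Real.exp (-2 * θ * x)) (weightedPenalty θ σ w t) t := by
    intro t
    have h1 : HasDerivAt (fun x => Real.exp (-2 * θ * x))
        (Real.exp (-2 * θ * t) * (-2 * θ * 1)) t :=
      ((hasDerivAt_id t).const_mul (-2 * θ)).exp
    have h2 := (((hasDerivAt_id t).sub_const (1 / (2 * θ))).const_mul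
      (w * σ ^ 2 / (2 * θ))).add (h1.const_mul (w * σ ^ 2 / (4 * θ ^ 2)))
    refine h2.congr_deriv ?_
    rw [weightedPenalty_of_pos hθ]
    field_simp
    ring
  have hc : Continuous (weightedPenalty θ σ w) := continuous_const.mul continuous_penalty
  rw [prim, intervalIntegral.integral_eq_sub_of_hasDerivAt (fun t _ => hd t)
    (hc.intervalIntegrable _ _)]
  simp
  field_simp
  ring

variable {ν : Measure ℝ} [IsProbabilityMeasure ν]

lemma integrable_exp_neg (hθ : 0 < θ) (h0 : ∀ᵐ y ∂ν, 0 ≤ y) {u : ℝ} (hu : 0 ≤ u) :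
    Integrable (fun y => Real.exp (-2 * θ * (u + y))) ν := by
  refine Integrable.of_bound (Continuous.aestronglyMeasurable (by fun_prop)) 1 ?_
  filter_upwards [h0] with y hy
  rw [Real.norm_eq_abs, abs_of_pos (Real.exp_pos _), Real.exp_le_one_iff]
  have : 0 ≤ θ * (u + y) := by positivity
  linarith

lemma deliveryRate_of_pos (hθ : 0 < θ) (h0 : ∀ᵐ y ∂ν, 0 ≤ y) {x : ℝ} (hx : 0 ≤ x) :
    deliveryRate (weightedPenalty θ σ w) ν x =
      w * σ ^ 2 / (2 * θ) * (1 - ∫ y, Real.exp (-2 * θ * (x + y)) ∂ν) := by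
  unfold deliveryRate
  simp only [weightedPenalty_of_pos hθ]
  rw [integral_const_mul, integral_sub (integrable_const _) (integrable_exp_neg hθ h0 hx)]
  simp

lemma deliveryRate_lt_of_pos (hθ : 0 < θ) (hσ : 0 < σ) (hw : 0 < w) (h0 : ∀ᵐ y ∂ν, 0 ≤ y) {x : ℝ}
    (hx : 0 ≤ x) : deliveryRate (weightedPenalty θ σ w) ν x < w * σ ^ 2 / (2 * θ) := by
  rw [deliveryRate_of_pos hθ h0 hx]
  have h1 : 0 < ∫ y, Real.exp (-2 * θ * (x + y)) ∂ν :=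
    integral_exp_pos (integrable_exp_neg hθ h0 hx)
  have h2 : 0 < w * σ ^ 2 / (2 * θ) := by positivity
  nlinarith

lemma tendsto_exp_neg_mul (hθ : 0 < θ) :
    Tendsto (fun x : ℝ => Real.exp (-2 * θ * x)) atTop (nhds 0) := by
  refine Real.tendsto_exp_atBot.comp ?_
  exact tendsto_id.const_mul_atTop_of_neg (by linarith)

lemma integral_exp_neg_le (hθ : 0 < θ) (h0 : ∀ᵐ y ∂ν, 0 ≤ y) {x : ℝ} (hx : 0 ≤ x) :
    ∫ y, Real.exp (-2 * θ * (x + y)) ∂ν ≤ Real.exp (-2 * θ * x) := by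
  calc _ ≤ ∫ _, Real.exp (-2 * θ * x) ∂ν := by
        refine integral_mono_ae (integrable_exp_neg hθ h0 hx) (integrable_const _) ?_
        filter_upwards [h0] with y hy
        refine Real.exp_le_exp.2 ?_
        have : 0 ≤ θ * y := by positivity
        linarith
    _ = _ := by simp

lemma exists_le_deliveryRate_of_pos (hθ : 0 < θ) (hσ : 0 < σ) (hw : 0 < w)
    (h0 : ∀ᵐ y ∂ν, 0 ≤ y) {b : ℝ} (hb : b < w * σ ^ 2 / (2 * θ)) :
    ∃ x, 0 ≤ x ∧ b ≤ deliveryRate (weightedPenalty θ σ w) ν x := by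
  have hB : 0 < w * σ ^ 2 / (2 * θ) := by positivity
  have hlim := ((tendsto_exp_neg_mul hθ).const_sub 1).const_mul (w * σ ^ 2 / (2 * θ))
  rw [sub_zero, mul_one] at hlim
  obtain ⟨x, hx, hx0⟩ := ((hlim.eventually_const_lt hb).and (eventually_ge_atTop 0)).exists
  refine ⟨x, hx0, hx.le.trans ?_⟩
  rw [deliveryRate_of_pos hθ h0 hx0]
  exact mul_le_mul_of_nonneg_left (by linarith [integral_exp_neg_le hθ h0 hx0]) hB.le

lemma exists_le_deliveryRate_of_nonpos (hθ : θ ≤ 0) (hσ : 0 < σ) (hw : 0 < w)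
    (h0 : ∀ᵐ y ∂ν, 0 ≤ y) (h : IsRate (weightedPenalty θ σ w) ν) (b : ℝ) :
    ∃ x, 0 ≤ x ∧ b ≤ deliveryRate (weightedPenalty θ σ w) ν x := by
  have hx : 0 ≤ |b| / (w * σ ^ 2) := by positivity
  refine ⟨|b| / (w * σ ^ 2), hx, ?_⟩
  calc b ≤ |b| := le_abs_self b
    _ = w * (σ ^ 2 * (|b| / (w * σ ^ 2))) := by field_simp
    _ ≤ weightedPenalty θ σ w (|b| / (w * σ ^ 2)) :=
        mul_le_mul_of_nonneg_left (le_penalty_of_nonpos hθ _) hw.le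
    _ = ∫ _, weightedPenalty θ σ w (|b| / (w * σ ^ 2)) ∂ν := by simp
    _ ≤ _ := by
        refine integral_mono_ae (integrable_const _) (h.integrable_rate h0 hx) ?_
        filter_upwards [h0] with y hy
        exact h.mono (by linarith)

lemma integral_prim_of_pos (hθ : 0 < θ) (h0 : ∀ᵐ y ∂ν, 0 ≤ y)
    (hid : Integrable (fun y => y) ν) :
    ∫ y, prim (weightedPenalty θ σ w) y ∂ν =
      w * σ ^ 2 / (2 * θ) * (∫ y, y ∂ν - 1 / (2 * θ))
      + w * σ ^ 2 / (4 * θ ^ 2) * ∫ y, Real.exp (-2 * θ * y) ∂ν := by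
  have hi : Integrable (fun y => Real.exp (-2 * θ * y)) ν := by
    simpa using integrable_exp_neg hθ h0 le_rfl
  have hs : Integrable (fun y => y - 1 / (2 * θ)) ν := hid.sub (integrable_const _)
  simp only [prim_weightedPenalty_of_pos hθ]
  rw [integral_add (hs.const_mul _) (hi.const_mul _),
    integral_const_mul, integral_const_mul, integral_sub hid (integrable_const _)]
  simp

/-- At the saturation level the linear part of `prim` cancels the reward for the cycle length, and
only exponentials remain. The last term is nonnegative and vanishes as `τ → ∞`, so the other two
decide whether sampling pays. -/
lemma gain_of_pos (hθ : 0 < θ) (h0 : ∀ᵐ y ∂ν, 0 ≤ y) (hid : Integrable (fun y => y) ν)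
    (lam : ℝ) {τ : ℝ} (hτ : 0 ≤ τ) :
    gain (weightedPenalty θ σ w) ν lam (w * σ ^ 2 / (2 * θ)) τ = lam * ∫ y, y ∂ν
      - w * σ ^ 2 / (4 * θ ^ 2) * ∫ y, Real.exp (-2 * θ * y) ∂ν
      + w * σ ^ 2 / (4 * θ ^ 2) *
        ∫ z : ℝ × ℝ, Real.exp (-2 * θ * (max z.1 τ + z.2)) ∂(ν.prod ν) := by
  have hi : Integrable (fun z : ℝ × ℝ => Real.exp (-2 * θ * (max z.1 τ + z.2))) (ν.prod ν) := by
    refine Integrable.of_bound (Continuous.aestronglyMeasurable (by fun_prop)) 1 ?_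
    filter_upwards [ae_prod_nonneg h0] with z hz
    rw [Real.norm_eq_abs, abs_of_pos (Real.exp_pos _), Real.exp_le_one_iff]
    have h1 : 0 ≤ max z.1 τ + z.2 := add_nonneg (hτ.trans (le_max_right _ _)) hz.2
    have : 0 ≤ θ * (max z.1 τ + z.2) := by positivity
    linarith
  have hm1 : Integrable (fun z : ℝ × ℝ => max z.1 τ) (ν.prod ν) :=
    (integrable_max hid τ).comp_fst ν
  have hm2 : Integrable (fun z : ℝ × ℝ => z.2) (ν.prod ν) := hid.comp_snd ν
  have hm : Integrable (fun z : ℝ × ℝ => max z.1 τ + z.2) (ν.prod ν) := hm1.add hm2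
  have e1 : ∫ z : ℝ × ℝ, max z.1 τ ∂(ν.prod ν) = ∫ y, max y τ ∂ν := by
    rw [integral_fun_fst (fun y => max y τ)]
    simp
  have e2 : ∫ z : ℝ × ℝ, z.2 ∂(ν.prod ν) = ∫ y, y ∂ν := by
    rw [integral_fun_snd (fun y => y)]
    simp
  have hs : Integrable (fun z : ℝ × ℝ => max z.1 τ + z.2 - 1 / (2 * θ)) (ν.prod ν) :=
    hm.sub (integrable_const _)
  rw [gain, integral_prim_of_pos hθ h0 hid]
  simp only [prim_weightedPenalty_of_pos hθ]
  rw [integral_add (hs.const_mul _) (hi.const_mul _),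
    integral_const_mul, integral_const_mul, integral_sub hm (integrable_const _),
    integral_add hm1 hm2, e1, e2]
  simp only [integral_const, probReal_univ, one_smul]
  ring

lemma exists_gain_neg_of_pos (hθ : 0 < θ) (hσ : 0 < σ) (hw : 0 < w) (h0 : ∀ᵐ y ∂ν, 0 ≤ y)
    (hid : Integrable (fun y => y) ν) (hpos : 0 < ∫ y, y ∂ν) {lam : ℝ}
    (hlam : lam * ∫ y, y ∂ν < w * σ ^ 2 / (4 * θ ^ 2) * ∫ y, Real.exp (-2 * θ * y) ∂ν) :
    ∃ b τ, (∃ x, 0 ≤ x ∧ b ≤ deliveryRate (weightedPenalty θ σ w) ν x) ∧ 0 ≤ τ ∧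
      gain (weightedPenalty θ σ w) ν lam b τ < 0 := by
  have hK : 0 < w * σ ^ 2 / (4 * θ ^ 2) := by positivity
  have hlim := (tendsto_exp_neg_mul hθ).const_mul (w * σ ^ 2 / (4 * θ ^ 2))
  rw [mul_zero] at hlim
  obtain ⟨τ, hτ, hτ0⟩ := ((hlim.eventually_lt_const (sub_pos.2 hlam)).and
    (eventually_ge_atTop 0)).exists
  have h1 : ∫ z : ℝ × ℝ, Real.exp (-2 * θ * (max z.1 τ + z.2)) ∂(ν.prod ν) ≤
      Real.exp (-2 * θ * τ) := by
    calc _ ≤ ∫ _, Real.exp (-2 * θ * τ) ∂(ν.prod ν) := by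
          refine integral_mono_of_nonneg (ae_of_all _ fun z => (Real.exp_pos _).le)
            (integrable_const _) ?_
          filter_upwards [ae_prod_nonneg h0] with z hz
          refine Real.exp_le_exp.2 ?_
          have h2 : τ ≤ max z.1 τ + z.2 := by linarith [le_max_right z.1 τ, hz.2]
          nlinarith
      _ = _ := by simp
  have h2 : gain (weightedPenalty θ σ w) ν lam (w * σ ^ 2 / (2 * θ)) τ < 0 := by
    rw [gain_of_pos hθ h0 hid lam hτ0]
    have := mul_le_mul_of_nonneg_left h1 hK.le
    linarith
  set B := w * σ ^ 2 / (2 * θ)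
  set g := gain (weightedPenalty θ σ w) ν lam B τ
  have hL : 0 < ∫ y, max y τ ∂ν := hpos.trans_le (integral_le_integral_max hid τ)
  -- The level `B` itself is never reached. Lowering the reward by this amount adds `-g / 2` to the
  -- gain, which leaves `g / 2 < 0`.
  refine ⟨B - (-g / 2) / ∫ y, max y τ ∂ν, τ,
    exists_le_deliveryRate_of_pos hθ hσ hw h0 (sub_lt_self _ (by
      exact div_pos (by linarith) hL)), hτ0, ?_⟩
  have h3 := gain_sub_gain (r := weightedPenalty θ σ w) (ν := ν) lam
    (B - (-g / 2) / ∫ y, max y τ ∂ν) B τ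
  rw [sub_sub_cancel, div_mul_cancel₀ _ hL.ne'] at h3
  change _ - g = _ at h3
  linarith

lemma exists_gain_neg_of_nonpos (hθ : θ ≤ 0) (hσ : 0 < σ) (hw : 0 < w) (h0 : ∀ᵐ y ∂ν, 0 ≤ y)
    (h : IsRate (weightedPenalty θ σ w) ν)
    (hid : Integrable (fun y => y) ν) (hpos : 0 < ∫ y, y ∂ν) (lam : ℝ) :
    ∃ b τ, (∃ x, 0 ≤ x ∧ b ≤ deliveryRate (weightedPenalty θ σ w) ν x) ∧ 0 ≤ τ ∧
      gain (weightedPenalty θ σ w) ν lam b τ < 0 := by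
  have hL : 0 < ∫ y, max y 0 ∂ν := hpos.trans_le (integral_le_integral_max hid 0)
  set g := gain (weightedPenalty θ σ w) ν lam 0 0
  -- This reward brings the gain at threshold `0` to exactly `-1`.
  refine ⟨(g + 1) / ∫ y, max y 0 ∂ν, 0, exists_le_deliveryRate_of_nonpos hθ hσ hw h0 h _,
    le_rfl, ?_⟩
  have h3 := gain_sub_gain (r := weightedPenalty θ σ w) (ν := ν) lam
    ((g + 1) / ∫ y, max y 0 ∂ν) 0 0
  rw [zero_sub, neg_mul, div_mul_cancel₀ _ hL.ne'] at h3
  change _ - g = _ at h3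
  linarith

end Limits

/-! ### Optimality and the root equation -/

section Optimality

variable {Ω : Type*} [MeasurableSpace Ω] {P : Measure Ω} [IsProbabilityMeasure P]
  {Y : ℕ → Ω → ℝ≥0} {θ σ w lam b τ : ℝ}

/-- A bound over all causal policies that is attained is the optimal value. -/
lemma isOptimal_of_bounds {S : ℕ → Ω → ℝ≥0∞} (hS : IsCausal P Y S)
    (hub : avgCost P θ σ w lam Y S ≤ (b : EReal))
    (hlb : ∀ S', IsCausal P Y S' → (b : EReal) ≤ avgCost P θ σ w lam Y S') :
    IsOptimal P θ σ w lam Y S ∧ optValue P θ σ w lam Y = (b : EReal) := by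
  have h1 : optValue P θ σ w lam Y = (b : EReal) :=
    le_antisymm ((iInf₂_le S hS).trans hub) (le_iInf₂ hlb)
  exact ⟨⟨hS, by rw [h1]; exact le_antisymm hub (hlb S hS)⟩, h1⟩

lemma avgCost_le_of_certificate (hY : ∀ i, Measurable (Y i))
    (hident : ∀ i, IdentDistrib (Y i) (Y 0) P P)
    (hint : Integrable (fun ω => (Y 0 ω : ℝ)) P) (hpos : 0 < ∫ ω, (Y 0 ω : ℝ) ∂P)
    {S : ℕ → Ω → ℝ≥0∞} (hS : IsCausal P Y S) {Q : ℝ → ℝ}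
    (hc : Certificate P Y S (fun x => -weightedPenalty θ σ w x) Q (-lam) (-b)) :
    avgCost P θ σ w lam Y S ≤ (b : EReal) := by
  refine limsup_le_coe (f := meanCost P (weightedPenalty θ σ w) lam Y S) fun ε hε => ?_
  filter_upwards [hc.eventually_le hY hident hint hpos hS hε] with T hT
  rwa [meanCost_neg] at hT

lemma isCausal_threshold (hY : ∀ i, Measurable (Y i)) (hindep : iIndepFun Y P)
    (hident : ∀ i, IdentDistrib (Y i) (Y 0) P P)
    (hc : Continuous (weightedPenalty θ σ w))
    (ht : IsThreshold (weightedPenalty θ σ w) (law P Y) b τ) :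
    IsCausal P Y (threshold P θ σ w Y b) :=
  isCausal_of_succ hY hindep (fun _ => rfl) _ (threshold_succ hY hident hc ht)

/-- Threshold policies with vanishing net cost are optimal. -/
lemma isOptimal_threshold (hY : ∀ i, Measurable (Y i)) (hindep : iIndepFun Y P)
    (hident : ∀ i, IdentDistrib (Y i) (Y 0) P P)
    (hint : Integrable (fun ω => (Y 0 ω : ℝ)) P) (hpos : 0 < ∫ ω, (Y 0 ω : ℝ) ∂P)
    (hr : IsRate (weightedPenalty θ σ w) (law P Y))
    (ht : IsThreshold (weightedPenalty θ σ w) (law P Y) b τ)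
    (hg : gain (weightedPenalty θ σ w) (law P Y) lam b τ = 0) :
    IsOptimal P θ σ w lam Y (threshold P θ σ w Y b) ∧
      optValue P θ σ w lam Y = (b : EReal) := by
  have := isProbabilityMeasure_law (P := P) hY
  have h0 := ae_law_nonneg (P := P) hY
  have hid := integrable_law_id hY hint
  have hS := isCausal_threshold hY hindep hident hr.cont ht
  refine isOptimal_of_bounds hS ?_ fun S' hS' => ?_
  · exact avgCost_le_of_certificate hY hident hint hpos hS
      (hr.certificate_neg hY hint ht (threshold_succ hY hident hr.cont ht) hg.le)
  · refine coe_le_limsup (f := meanCost P (weightedPenalty θ σ w) lam Y S') fun ε hε => ?_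
    -- Half of `ε` is spent on truncation and half on the verification theorem; the truncated cost
    -- is at most the true one.
    obtain ⟨M, τ', ht', hg'⟩ := hr.exists_truncRate h0 hid (by rwa [integral_law_id hY]) ht hg.ge
      (half_pos hε)
    have hrM := hr.truncRate h0 M
    rw [hrM.gain_eq h0 hid lam _ ht'.nonneg] at hg'
    have hcert := hrM.certificate hY hint hS' (fun x => min_le_right _ _)
      (Q := fun a => sampleCost (truncRate (weightedPenalty θ σ w) M) (law P Y) (b - ε / 2)
        (max a τ'))
      (fun a a' haa => hrM.sampleCost_mono h0 ht' (le_max_right _ _) (max_le_max_right _ haa))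
      (fun u hu => hrM.sampleCost_max_le h0 ht' hu le_rfl)
      (hrM.integrable_sampleCost_max h0 hid _ ht'.nonneg) hg'
    filter_upwards [hcert.eventually_le hY hident hint hpos hS' (half_pos hε),
      eventually_gt_atTop 0] with T hT hT0
    have := meanCost_mono (P := P) (lam := lam) hr.cont hrM.cont
      (fun x => truncRate_le (weightedPenalty θ σ w) M x) hY hS'.measurable hT0
    linarith

lemma isRoot_of_gain_eq_zero (hY : ∀ i, Measurable (Y i)) (hindep : iIndepFun Y P)
    (hident : ∀ i, IdentDistrib (Y i) (Y 0) P P)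
    (hint : Integrable (fun ω => (Y 0 ω : ℝ)) P)
    (hr : IsRate (weightedPenalty θ σ w) (law P Y))
    (ht : IsThreshold (weightedPenalty θ σ w) (law P Y) b τ)
    (hg : gain (weightedPenalty θ σ w) (law P Y) lam b τ = 0) (i : ℕ) :
    IsRoot P θ σ w lam Y i b := by
  have hsucc := threshold_succ hY hident hr.cont ht
  obtain ⟨h1, h2, -, h4⟩ := cycle_expectations hY hindep hident hint
    (isCausal_threshold hY hindep hident hr.cont ht) hr ht.nonneg hsucc lam b i
  refine ⟨ae_of_all _ fun ω => ?_, h1, h2, h4.trans hg⟩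
  exact ENNReal.add_ne_top.2
    ⟨ne_top_of_succ (fun _ => rfl) hsucc (i + 1) ω, ENNReal.coe_ne_top⟩

lemma exists_gain_eq_zero_of_isRoot (hY : ∀ i, Measurable (Y i)) (hindep : iIndepFun Y P)
    (hident : ∀ i, IdentDistrib (Y i) (Y 0) P P)
    (hint : Integrable (fun ω => (Y 0 ω : ℝ)) P)
    (hr : IsRate (weightedPenalty θ σ w) (law P Y)) {i : ℕ}
    (h : IsRoot P θ σ w lam Y i b) :
    ∃ τ, IsThreshold (weightedPenalty θ σ w) (law P Y) b τ ∧
      gain (weightedPenalty θ σ w) (law P Y) lam b τ = 0 := by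
  have := isProbabilityMeasure_law (P := P) hY
  have h0 := ae_law_nonneg (P := P) hY
  by_cases hex : ∃ x, 0 ≤ x ∧ b ≤ deliveryRate (weightedPenalty θ σ w) (law P Y) x
  · have ht := hr.isThreshold_sInf h0 hex
    obtain ⟨-, -, -, h4⟩ := cycle_expectations hY hindep hident hint
      (isCausal_threshold hY hindep hident hr.cont ht) hr ht.nonneg
      (threshold_succ hY hident hr.cont ht) lam b i
    exact ⟨_, ht, h4.symm.trans h.eq_zero⟩
  -- A reward above every delivery rate gives `S (i + 1) = ∞` everywhere, contrary to the finiteness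
  -- required of a root.
  · push Not at hex
    obtain ⟨ω, hω⟩ := h.finite.exists
    refine absurd ?_ hω
    rw [delivery, threshold_succ_eq_top hY hident hr.cont hex, top_add]

/-- When sampling is too expensive, never sampling again is optimal. -/
lemma isOptimal_never (hY : ∀ i, Measurable (Y i)) (hindep : iIndepFun Y P)
    (hident : ∀ i, IdentDistrib (Y i) (Y 0) P P)
    (hint : Integrable (fun ω => (Y 0 ω : ℝ)) P) (hpos : 0 < ∫ ω, (Y 0 ω : ℝ) ∂P)
    (hr : IsRate (weightedPenalty θ σ w) (law P Y)) (hθ : 0 < θ) (hw : 0 < w)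
    (hlam : w * σ ^ 2 / (4 * θ ^ 2) * ∫ y, Real.exp (-2 * θ * y) ∂(law P Y) ≤
      lam * ∫ y, y ∂(law P Y)) {S : ℕ → Ω → ℝ≥0∞} (hS0 : ∀ ω, S 0 ω = 0)
    (hsucc : ∀ n ω, S (n + 1) ω = ∞) :
    IsOptimal P θ σ w lam Y S ∧
      optValue P θ σ w lam Y = ((w * σ ^ 2 / (2 * θ) : ℝ) : EReal) := by
  have := isProbabilityMeasure_law (P := P) hY
  have h0 := ae_law_nonneg (P := P) hY
  have hid := integrable_law_id hY hint
  -- Never sampling again is the fixed-age policy with age `∞`.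
  have hS : IsCausal P Y S := isCausal_of_succ hY hindep hS0 ∞ fun n ω => by simp [hsucc]
  have hB : 0 ≤ w * σ ^ 2 / (2 * θ) := by positivity
  have hle : ∀ x, weightedPenalty θ σ w x ≤ w * σ ^ 2 / (2 * θ) := fun x => by
    rw [weightedPenalty_of_pos hθ]
    exact mul_le_of_le_one_right hB (by linarith [Real.exp_pos (-2 * θ * x)])
  refine isOptimal_of_bounds hS ?_ fun S' hS' => ?_
  · exact avgCost_le_of_certificate hY hident hint hpos hS
      (hr.certificate_neg_of_never hY hint hle hsucc lam)
  · refine coe_le_limsup (f := meanCost P (weightedPenalty θ σ w) lam Y S') fun ε hε => ?_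
    have hK : 0 ≤ w * σ ^ 2 / (4 * θ ^ 2) := by positivity
    -- The constant `Q` is the limit of `sampleCost u` as `u → ∞` at the saturation reward. It is a
    -- lower bound because the exponential term is nonnegative, and `value_nonneg` becomes exactly
    -- `hlam`.
    have hcert := hr.certificate (b := w * σ ^ 2 / (2 * θ)) (lam := lam) hY hint hS' hle
      (Q := fun _ => w * σ ^ 2 / (2 * θ) * (∫ y, y ∂(law P Y) - 1 / (2 * θ))) monotone_const
      (fun u hu => by
        have h1 : ∫ y, w * σ ^ 2 / (2 * θ) * (y + (u - 1 / (2 * θ))) ∂(law P Y) ≤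
            ∫ y, prim (weightedPenalty θ σ w) (u + y) ∂(law P Y) := by
          refine integral_mono ((hid.add (integrable_const _)).const_mul _)
            (hr.integrable_prim h0 hu) fun y => ?_
          simp only [prim_weightedPenalty_of_pos hθ]
          have := mul_nonneg hK (Real.exp_pos (-2 * θ * (u + y))).le
          linarith
        rw [integral_const_mul, integral_add hid (integrable_const _), integral_const,
          probReal_univ, one_smul] at h1
        unfold sampleCost
        linarith) (integrable_const _) (by
        rw [integral_prim_of_pos hθ h0 hid, integral_const, probReal_univ, one_smul]
        linarith)
    exact hcert.eventually_le hY hident hint hpos hS' hε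

end Optimality

end AoISampling

end

/-! ### The main theorem -/

theorem proposition2 {Ω : Type*} [MeasurableSpace Ω] (P : Measure Ω) [IsProbabilityMeasure P]
    (θ σ w lam : ℝ) (hσ : 0 < σ) (hw : 0 < w)
    (Y : ℕ → Ω → ℝ≥0) (hY : ∀ i, Measurable (Y i)) (hindep : iIndepFun Y P)
    (hident : ∀ i, IdentDistrib (Y i) (Y 0) P P)
    (hint : Integrable (fun ω => (Y 0 ω : ℝ)) P) (hpos : 0 < ∫ ω, (Y 0 ω : ℝ) ∂P)
    -- the expected penalty accumulated over two transmissions is finite (automatic if `0 < θ`)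
    (hfin : Integrable
      (fun ω => ∫ s in (0 : ℝ)..((Y 0 ω : ℝ) + (Y 1 ω : ℝ)), AoISampling.penalty θ σ s) P) :
    -- main case: for `0 < θ` the activation cost is below the level at which sampling stops
    ((0 < θ → lam * ∫ ω, (Y 0 ω : ℝ) ∂P <
        w * σ ^ 2 / (4 * θ ^ 2) * ∫ ω, Real.exp (-2 * θ * (Y 0 ω : ℝ)) ∂P) →
      ∃ β : ℝ,
        (∀ i, AoISampling.IsRoot P θ σ w lam Y i β ∧
          ∀ β', AoISampling.IsRoot P θ σ w lam Y i β' → β' = β) ∧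
        AoISampling.IsOptimal P θ σ w lam Y (AoISampling.threshold P θ σ w Y β) ∧
        (∀ i, AoISampling.optValue P θ σ w lam Y =
          (((∫ ω, AoISampling.cycleCost θ σ w Y (AoISampling.threshold P θ σ w Y β) i ω ∂P
              + lam * ∫ ω, (Y (i + 1) ω : ℝ) ∂P) /
            ∫ ω, AoISampling.cycleLength Y (AoISampling.threshold P θ σ w Y β) i ω ∂P : ℝ) :
            EReal)) ∧
        AoISampling.optValue P θ σ w lam Y = (β : EReal)) ∧
    -- otherwise there is no root, and the same rule with `β` the optimal value never samples
    ((0 < θ ∧ w * σ ^ 2 / (4 * θ ^ 2) * ∫ ω, Real.exp (-2 * θ * (Y 0 ω : ℝ)) ∂P ≤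
        lam * ∫ ω, (Y 0 ω : ℝ) ∂P) →
      (∀ i β, ¬ AoISampling.IsRoot P θ σ w lam Y i β) ∧
      (∀ i ω, AoISampling.threshold P θ σ w Y (w * σ ^ 2 / (2 * θ)) (i + 1) ω = ∞) ∧
      AoISampling.IsOptimal P θ σ w lam Y
        (AoISampling.threshold P θ σ w Y (w * σ ^ 2 / (2 * θ))) ∧
      AoISampling.optValue P θ σ w lam Y = ((w * σ ^ 2 / (2 * θ) : ℝ) : EReal)) := by
  have hν := AoISampling.isProbabilityMeasure_law (P := P) hY
  have h0 := AoISampling.ae_law_nonneg (P := P) hY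
  have hid := AoISampling.integrable_law_id hY hint
  have hpos' : 0 < ∫ y, y ∂(AoISampling.law P Y) := by rwa [AoISampling.integral_law_id hY]
  have hr := AoISampling.isRate_weightedPenalty (θ := θ) (σ := σ) hY hindep hident hint hw.le hfin
  have hexp : ∫ ω, Real.exp (-2 * θ * (Y 0 ω : ℝ)) ∂P =
      ∫ y, Real.exp (-2 * θ * y) ∂(AoISampling.law P Y) :=
    AoISampling.integral_comp_transmission hY hident (g := fun y => Real.exp (-2 * θ * y))
      (by fun_prop) 0
  rw [← AoISampling.integral_law_id hY, hexp]
  constructor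
  · intro hlam
    obtain ⟨b₁, τ₁, hb₁, hτ₁, hneg⟩ : ∃ b τ, (∃ x, 0 ≤ x ∧
        b ≤ AoISampling.deliveryRate (AoISampling.weightedPenalty θ σ w) (AoISampling.law P Y) x) ∧
        0 ≤ τ ∧ AoISampling.gain (AoISampling.weightedPenalty θ σ w) (AoISampling.law P Y)
          lam b τ < 0 := by
      rcases le_or_gt θ 0 with hθ | hθ
      · exact AoISampling.exists_gain_neg_of_nonpos hθ hσ hw h0 hr hid hpos' lam
      · exact AoISampling.exists_gain_neg_of_pos hθ hσ hw h0 hid hpos' (hlam hθ)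
    obtain ⟨β, τ, ht, hg⟩ := hr.exists_gain_eq_zero h0 hid lam hb₁ hτ₁ hneg
    obtain ⟨hopt, hval⟩ :=
      AoISampling.isOptimal_threshold hY hindep hident hint hpos hr ht hg
    refine ⟨β, fun i => ⟨AoISampling.isRoot_of_gain_eq_zero hY hindep hident hint hr ht hg i,
      fun β' hβ' => ?_⟩, hopt, fun i => ?_, hval⟩
    · obtain ⟨τ', ht', hg'⟩ :=
        AoISampling.exists_gain_eq_zero_of_isRoot hY hindep hident hint hr hβ'
      exact hr.gain_eq_zero_unique h0 hid hpos' ht' ht hg' hg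
    · obtain ⟨-, -, h3, h4⟩ := AoISampling.cycle_expectations hY hindep hident hint hopt.1 hr
        ht.nonneg (AoISampling.threshold_succ hY hident hr.cont ht) lam β i
      have hL : 0 < ∫ ω, AoISampling.cycleLength Y (AoISampling.threshold P θ σ w Y β) i ω ∂P := by
        rw [h3]
        exact hpos'.trans_le (AoISampling.integral_le_integral_max hid τ)
      rw [hval, EReal.coe_eq_coe_iff, eq_div_iff hL.ne']
      linarith
  · rintro ⟨hθ, hlam⟩
    have htop := AoISampling.threshold_succ_eq_top hY hident hr.cont
      (fun x hx => AoISampling.deliveryRate_lt_of_pos hθ hσ hw h0 hx)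
    refine ⟨fun i β hβ => ?_, htop, AoISampling.isOptimal_never hY hindep hident hint hpos hr hθ hw
      hlam (fun _ => rfl) htop⟩
    obtain ⟨τ, ht, hg⟩ := AoISampling.exists_gain_eq_zero_of_isRoot hY hindep hident hint hr hβ
    -- A root is attained by the delivery rate, hence lies strictly below saturation. At saturation
    -- `gain` is nonnegative by `hlam`, and it increases strictly as the reward decreases, so it
    -- cannot vanish at `β`.
    have hlt : β < w * σ ^ 2 / (2 * θ) := (ht.le (τ + 1) (by linarith)).trans_lt
      (AoISampling.deliveryRate_lt_of_pos hθ hσ hw h0 (by linarith [ht.nonneg]))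
    have h1 := AoISampling.gain_of_pos (σ := σ) (w := w) hθ h0 hid lam ht.nonneg
    have h2 := AoISampling.gain_sub_gain (r := AoISampling.weightedPenalty θ σ w)
      (ν := AoISampling.law P Y) lam β (w * σ ^ 2 / (2 * θ)) τ
    have h3 := mul_pos (sub_pos.2 hlt)
      (hpos'.trans_le (AoISampling.integral_le_integral_max hid τ))
    have h4 : 0 ≤ w * σ ^ 2 / (4 * θ ^ 2) * ∫ z : ℝ × ℝ, Real.exp (-2 * θ * (max z.1 τ + z.2))
        ∂((AoISampling.law P Y).prod (AoISampling.law P Y)) :=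
      mul_nonneg (by positivity) (integral_nonneg fun z => (Real.exp_pos _).le)
    linarith
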